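/- Gaussian approximation. Notation: $h(p)=-p\log_2 p-(1-p)\log_2(1-p)$ is the binary entropy ($h(0)=0$); $\bar h(x)=h(x)$ for $x<1/2$ and $\bar h(x)=1$ for $x\ge 1/2$; $$P_{hg}(k|n,l,j)=\binom{l}{k}\binom{n}{j-k}\Big/\binom{n+l}{j}$$ is the hypergeometric distribution (zero if $k>j$); $$f(k',k|n,l,\delta)=\begin{cases}\min\{2^{n(h(k'/n)-h(k/l+\delta))},1\}& \text{if } k'<n/2,\\ 1&\text{if } k'\ge n/2;\end{cases}$$ $$S_j(\delta,n,l,\underline k,\overline k)=\sum_{k=0}^{\underline k}P_{hg}(k|n,l,j)\,f((j-\underline k)_+,\underline k|n,l,\delta_k)+\sum_{k=\underline k+1}^{\overline k}P_{hg}(k|n,l,j)\,f(j-k,k|n,l,\delta_k),$$ where $x_+=\max\{x,0\}$; and, for a code rate $R$, $$\tilde P(\delta,n,l,\underline k,\overline k)=\max_{0\le j\le n+l}\frac{\bar h(S_j(\delta,n,l,\underline k,\overline k))}{n(R-h(\overline k/l+\delta_{\overline k}))}+\max_{0\le j\le n+l}S_j(\delta,n,l,\underline k,\overline k).$$ Let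 $0<\underline p<\overline p<1/2$, let $0<r<1$, and let $\tilde\epsilon:[0,1]\to\mathbb R$ be continuous. Consider sequences of integers $n\to\infty$, $l$, $\underline k$, $\overline k\ge 0$ with $n/(n+l)\to r$, $\underline k/l\to\underline p$, $\overline k/l\to\overline p$ (for instance $n/(n+l)=r$, $\underline k=\underline p\,l$, $\overline k=\overline p\,l$, exactly or up to rounding to integers), put $\delta_k=\tilde\epsilon(k/l)/\sqrt{n+l}$, and let the code rates $R$ (which may be constant or vary along the sequence) be eventually at least some constant $R_0>h(\overline p)$. Then the limit of $\tilde P$ exists, the maximum on the right-hand side is attained, and $$\lim_{n\to\infty}\tilde P(\delta,n,l,\underline k,\overline k)=\max_{p\in[\underline p,\overline p]}\Phi\left(-\frac{\sqrt{r(1-r)}}{\sqrt{p(1-p)}}\,\tilde\epsilon(p)\right),$$ where $\Phi$ is the distribution function of the standard normal distribution. -/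

import Mathlib

noncomputable section

namespace QKD

/-- The binary entropy in bits, `h p = -p log₂ p - (1 - p) log₂ (1 - p)`. -/
def h (p : ℝ) : ℝ := Real.binEntropy p / Real.log 2

/-- The truncated binary entropy: `h x` for `x < 1/2`, and `1` for `x ≥ 1/2`. -/
def hBar (x : ℝ) : ℝ := if x < 1 / 2 then h x else 1

/-- The hypergeometric distribution `P_hg(k | n, l, j) = C(l, k) C(n, j - k) / C(n + l, j)`, where
`C(n, j - k)` is zero for `j < k`. -/
def Phg (k n l j : ℕ) : ℝ :=
  if k ≤ j then ((l.choose k : ℝ) * (n.choose (j - k) : ℝ)) / ((n + l).choose j : ℝ) else 0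

/-- `f(k', k | n, l, δ)`: the minimum of `2 ^ (n (h (k' / n) - h (k / l + δ)))` and `1`
if `k' < n / 2`, and `1` if `k' ≥ n / 2`. -/
def f (k' k n l : ℕ) (δ : ℝ) : ℝ :=
  if (k' : ℝ) < (n : ℝ) / 2 then
    min ((2 : ℝ) ^ ((n : ℝ) * (h ((k' : ℝ) / n) - h ((k : ℝ) / l + δ)))) 1
  else 1

/-- The sum that occurs in both terms of the bound, for `j` errors among the `n + l` bits.
In the first sum the number `j - kL` of errors is read as `0` if `j < kL`; in the second sum the
terms with `j < k` vanish because of the factor `Phg`. -/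
def errSum (δ : ℕ → ℝ) (n l kL kU j : ℕ) : ℝ :=
  ∑ k ∈ Finset.range (kL + 1), Phg k n l j * f (j - kL) kL n l (δ k)
    + ∑ k ∈ Finset.Ioc kL kU, Phg k n l j * f (j - k) k n l (δ k)

/-- The bound `P̃(δ, n, l, kL, kU)` on the eavesdropper's information per bit, for a code of
rate `R`; both maxima are over `j = 0, …, n + l`. -/
def PTilde (R : ℝ) (δ : ℕ → ℝ) (n l kL kU : ℕ) : ℝ :=
  (Finset.range (n + l + 1)).sup' Finset.nonempty_range_add_one
      (fun j => 1 / ((n : ℝ) * (R - h ((kU : ℝ) / l + δ kU))) * hBar (errSum δ n l kL kU j))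
    + (Finset.range (n + l + 1)).sup' Finset.nonempty_range_add_one
      (fun j => errSum δ n l kL kU j)

/-- The distribution function of the standard normal distribution. -/
def Phi (x : ℝ) : ℝ := ProbabilityTheory.cdf (ProbabilityTheory.gaussianReal 0 1) x

end QKD

end

namespace QKD

open Filter Topology Real ProbabilityTheory MeasureTheory

/-! Let `j / (n + l) → q`. The number `k` of errors in the sample is hypergeometric with mean `l j /
(n + l)`; its deviation `z`, in units of `√(n + l)`, is asymptotically normal with variance `r (1 -
r) q (1 - q)`. By `rate_gap_eq` the tolerated error rate exceeds the rate on the key by `((n + l)² /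
(n l) · z + ε (k / l)) / √(n + l)`. A negative gap gives `f = 1`; a gap of at least `c / √(n + l)`
with `c > 0` makes the exponent in `f` of order `-√n`. So `f` acts as the indicator of `z < -r (1 -
r) ε q`, and for `pL < q < pU` the error sum tends to `Phi (gaussArg r ε q)`.

For `q < pL` every `f` is small, and for `q > pU` the event `k ≤ kU` has vanishing probability. On
all of `[pL, pU]` the Gaussian value is an upper bound; interior points suffice for the lower bound,
because that value is continuous in `q`. Compactness of `[0, 1]` makes the upper bound uniform in
`j`. The entropy term is `O(1 / n)`.

The normal limit comes from Stirling's formula: a local limit theorem for binomial weights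
(`tendsto_sqrt_mul_binomWeight`) passes to the hypergeometric weights by conditioning
(`tendsto_sqrt_mul_Phg`). Fatou's lemma turns it into lower bounds on open sets, and total mass one
gives the upper bounds. -/

/-! ### Second order expansion of relative entropy. -/

theorem abs_one_add_mul_log_sub_le {t : ℝ} (ht : |t| ≤ 1 / 2) :
    |(1 + t) * log (1 + t) - t - t ^ 2 / 2| ≤ 4 * |t| ^ 3 := by
  have h1 : |-t| < 1 := by rw [abs_neg]; linarith
  have h2 := abs_log_sub_add_sum_range_le h1 2
  rw [abs_neg] at h2
  simp only [Finset.sum_range_succ, Finset.sum_range_zero] at h2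
  have h3 : |t| ^ 3 / (1 - |t|) ≤ 2 * |t| ^ 3 := by
    rw [div_le_iff₀ (by linarith)]
    have : 0 ≤ |t| ^ 3 := by positivity
    nlinarith
  have h4 := h2.trans h3
  set e := log (1 + t) - t + t ^ 2 / 2 with he
  have h5 : |e| ≤ 2 * |t| ^ 3 := by
    have h : e = 0 + (-t) ^ (0 + 1) / (↑(0 : ℕ) + 1) + (-t) ^ (1 + 1) / (↑(1 : ℕ) + 1)
        + log (1 - -t) := by
      rw [he, sub_neg_eq_add]
      push_cast
      ring
    rwa [h]
  have h6 : (1 + t) * log (1 + t) - t - t ^ 2 / 2 = (1 + t) * e - t ^ 3 / 2 := by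
    rw [he]; ring
  rw [h6]
  calc |(1 + t) * e - t ^ 3 / 2| ≤ |(1 + t) * e| + |t ^ 3 / 2| := abs_sub _ _
    _ = |1 + t| * |e| + |t| ^ 3 / 2 := by rw [abs_mul, abs_div, abs_pow, abs_two]
    _ ≤ (3 / 2) * (2 * |t| ^ 3) + |t| ^ 3 / 2 := by
        have : |1 + t| ≤ 3 / 2 := by
          have := abs_add_le 1 t
          rw [abs_one] at this
          linarith
        gcongr
    _ ≤ 4 * |t| ^ 3 := by
        have : 0 ≤ |t| ^ 3 := by positivity
        linarith

/-- Second order expansion of the relative entropy term `k log (k / c)` for `k = c + O(√c)`. -/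
theorem tendsto_mul_log_div_sub {c k : ℕ → ℝ} {y : ℝ} (hc : Tendsto c atTop atTop)
    (hy : Tendsto (fun i => (k i - c i) / √(c i)) atTop (𝓝 y)) :
    Tendsto (fun i => k i * log (k i / c i) - (k i - c i)) atTop (𝓝 (y ^ 2 / 2)) := by
  set t : ℕ → ℝ := fun i => (k i - c i) / c i with ht
  have hcpos : ∀ᶠ i in atTop, 0 < c i := hc.eventually_gt_atTop 0
  have hsq : Tendsto (fun i => √(c i)) atTop atTop := tendsto_sqrt_atTop.comp hc
  have ht0 : Tendsto t atTop (𝓝 0) := by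
    have h := hy.div_atTop hsq
    refine h.congr' ?_
    filter_upwards [hcpos] with i hi
    rw [ht, div_div, mul_self_sqrt hi.le]
  have hct : Tendsto (fun i => c i * t i ^ 2) atTop (𝓝 (y ^ 2)) := by
    refine (hy.pow 2).congr' ?_
    filter_upwards [hcpos] with i hi
    rw [ht, div_pow, sq_sqrt hi.le]
    field_simp
  -- Since `k = c (1 + t)`, the cubic remainder is at most `4 (c t²) |t|`, where `c t²` converges
  -- and `t → 0`.
  have herr : Tendsto (fun i => k i * log (k i / c i) - (k i - c i) - c i * t i ^ 2 / 2)
      atTop (𝓝 0) := by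
    have hb : Tendsto (fun i => 4 * (c i * t i ^ 2) * |t i|) atTop (𝓝 0) := by
      simpa using (hct.const_mul 4).mul ht0.abs
    refine squeeze_zero_norm' ?_ hb
    have hsmall : ∀ᶠ i in atTop, |t i| ≤ 1 / 2 := by
      have := ht0.abs
      rw [abs_zero] at this
      exact (this.eventually_lt_const (by norm_num : (0 : ℝ) < 1 / 2)).mono fun _ h => h.le
    filter_upwards [hcpos, hsmall] with i hi hti
    have h1 := abs_one_add_mul_log_sub_le hti
    have hk : k i = c i * (1 + t i) := by rw [ht]; field_simp; ring
    have hk' : k i / c i = 1 + t i := by rw [hk]; field_simp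
    have : k i * log (k i / c i) - (k i - c i) - c i * t i ^ 2 / 2
        = c i * ((1 + t i) * log (1 + t i) - t i - t i ^ 2 / 2) := by
      rw [hk', hk]; ring
    rw [this, norm_eq_abs, abs_mul, abs_of_pos hi]
    calc c i * _ ≤ c i * (4 * |t i| ^ 3) := by gcongr
      _ = 4 * (c i * t i ^ 2) * |t i| := by rw [← sq_abs (t i)]; ring
  have := herr.add (hct.div_const 2)
  simpa using this

/-! ### Stirling's formula and the local limit theorem for binomial weights. -/

/-- The weight of `k` under the binomial distribution with parameters `n` and `p`. -/
noncomputable def binomWeight (p : ℝ) (n k : ℕ) : ℝ := n.choose k * p ^ k * (1 - p) ^ (n - k)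

theorem factorial_eq_stirlingSeq_mul {n : ℕ} (hn : n ≠ 0) :
    (n.factorial : ℝ) = Stirling.stirlingSeq n * (√2 * √n * (n / exp 1) ^ n) := by
  have : (0 : ℝ) < n := by positivity
  rw [Stirling.stirlingSeq, sqrt_mul zero_le_two, div_mul_cancel₀ _ (by positivity)]

/-- An exact identity that separates a convergent Stirling factor, the scale `1 / √n` and the
relative entropy; the powers of `e` cancel. The strict bounds on `k` matter because
`Stirling.stirlingSeq 0 = 0`. -/
theorem binomWeight_eq_stirling {p : ℝ} (hp0 : 0 < p) (hp1 : p < 1) {n k : ℕ} (hk0 : 0 < k)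
    (hkn : k < n) :
    binomWeight p n k =
      Stirling.stirlingSeq n / (Stirling.stirlingSeq k * Stirling.stirlingSeq (n - k))
        * (√n / (√2 * √k * √(n - k : ℕ)))
        * exp (-((k * log (k / (n * p)) + (n - k : ℕ) * log ((n - k : ℕ) / (n * (1 - p)))))) := by
  obtain ⟨m, rfl⟩ : ∃ m, n = k + m := ⟨n - k, by omega⟩
  have hm : 0 < m := by omega
  have hq : 0 < 1 - p := by linarith
  have hkR : (0 : ℝ) < k := by positivity
  have hmR : (0 : ℝ) < m := by positivity
  have hn : (0 : ℝ) < ((k + m : ℕ) : ℝ) := by positivity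
  have hpos : ∀ a : ℕ, 0 < a → 0 < Stirling.stirlingSeq a := fun a ha => by
    obtain ⟨b, rfl⟩ : ∃ b, a = b + 1 := ⟨a - 1, by omega⟩
    exact Stirling.stirlingSeq'_pos b
  have h1 := hpos k hk0
  have h2 := hpos m hm
  have h3 := hpos (k + m) (by omega)
  have hE : ∀ (a : ℕ) (x : ℝ), 0 < x → exp (-(a * log x)) = (x ^ a)⁻¹ := fun a x hx => by
    rw [exp_neg, mul_comm, exp_mul, exp_log hx, rpow_natCast]
  rw [binomWeight, Nat.add_sub_cancel_left, neg_add, exp_add, hE _ _ (by positivity),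
    hE _ _ (by positivity), Nat.cast_choose ℝ (Nat.le_add_right k m), Nat.add_sub_cancel_left,
    factorial_eq_stirlingSeq_mul hk0.ne', factorial_eq_stirlingSeq_mul hm.ne',
    factorial_eq_stirlingSeq_mul (by omega : k + m ≠ 0)]
  simp only [div_pow, mul_pow, pow_add]
  generalize ((k + m : ℕ) : ℝ) = N at *
  field_simp

/-- Local de Moivre–Laplace theorem. -/
theorem tendsto_sqrt_mul_binomWeight {n k : ℕ → ℕ} {p : ℕ → ℝ} {q y : ℝ} (hq0 : 0 < q)
    (hq1 : q < 1) (hn : Tendsto n atTop atTop) (hp : Tendsto p atTop (𝓝 q))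
    (hy : Tendsto (fun i => ((k i : ℝ) - n i * p i) / √(n i)) atTop (𝓝 y)) :
    Tendsto (fun i => √(n i) * binomWeight (p i) (n i) (k i)) atTop
      (𝓝 (1 / √(2 * π * (q * (1 - q))) * exp (-(y ^ 2 / (2 * (q * (1 - q))))))) := by
  have hq : 0 < 1 - q := by linarith
  have hnR : Tendsto (fun i => (n i : ℝ)) atTop atTop := tendsto_natCast_atTop_atTop.comp hn
  have hsq : Tendsto (fun i => √(n i : ℝ)) atTop atTop := tendsto_sqrt_atTop.comp hnR
  have hnpos : ∀ᶠ i in atTop, (0 : ℝ) < n i := hnR.eventually_gt_atTop 0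
  have hkn : Tendsto (fun i => (k i : ℝ) / n i) atTop (𝓝 q) := by
    have h := (hy.div_atTop hsq).add hp
    rw [zero_add] at h
    refine h.congr' ?_
    filter_upwards [hnpos] with i hi
    rw [div_div, mul_self_sqrt hi.le]
    field_simp
    ring
  have hk0 : ∀ᶠ i in atTop, 0 < k i := by
    filter_upwards [hkn.eventually_const_lt hq0, hnpos] with i hi hni
    have : (0 : ℝ) < k i := by
      by_contra hcon
      exact absurd hi (not_lt.2 (div_nonpos_of_nonpos_of_nonneg (not_lt.1 hcon) hni.le))
    exact_mod_cast this
  have hkn1 : ∀ᶠ i in atTop, k i < n i := by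
    filter_upwards [hkn.eventually_lt_const hq1, hnpos] with i hi hni
    rw [div_lt_one hni] at hi
    exact_mod_cast hi
  have hcast : ∀ᶠ i in atTop, ((n i - k i : ℕ) : ℝ) = n i - k i := by
    filter_upwards [hkn1] with i hi
    exact Nat.cast_sub hi.le
  have hkn' : Tendsto (fun i => ((n i - k i : ℕ) : ℝ) / n i) atTop (𝓝 (1 - q)) := by
    refine (hkn.const_sub 1).congr' ?_
    filter_upwards [hcast, hnpos] with i hi hni
    rw [hi]
    field_simp
  have hkinf : Tendsto k atTop atTop := by
    have : Tendsto (fun i => (k i : ℝ)) atTop atTop := by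
      refine (hnR.atTop_mul_pos hq0 hkn).congr' ?_
      filter_upwards [hnpos] with i hi
      field_simp
    exact tendsto_natCast_atTop_iff.1 this
  have hmkinf : Tendsto (fun i => n i - k i) atTop atTop := by
    have : Tendsto (fun i => ((n i - k i : ℕ) : ℝ)) atTop atTop := by
      refine (hnR.atTop_mul_pos hq hkn').congr' ?_
      filter_upwards [hnpos] with i hi
      field_simp
    exact tendsto_natCast_atTop_iff.1 this
  have hs := Stirling.tendsto_stirlingSeq_sqrt_pi
  have hπ : √π ≠ 0 := by positivity
  have hA := (hs.comp hn).div ((hs.comp hkinf).mul (hs.comp hmkinf)) (by positivity)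
  have hB : Tendsto (fun i => √(n i : ℝ) * (√(n i : ℝ) / (√2 * √(k i) * √(n i - k i : ℕ))))
      atTop (𝓝 (1 / (√2 * √q * √(1 - q)))) := by
    have h := ((hkn.sqrt.const_mul √2).mul hkn'.sqrt).inv₀ (by positivity)
    rw [one_div]
    refine h.congr' ?_
    filter_upwards [hnpos] with i hi
    rw [sqrt_div (Nat.cast_nonneg _), sqrt_div (Nat.cast_nonneg _)]
    have : 0 < √(n i : ℝ) := by positivity
    field_simp
  have hc1 : Tendsto (fun i => (n i : ℝ) * p i) atTop atTop := hnR.atTop_mul_pos hq0 hp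
  have hp' : Tendsto (fun i => 1 - p i) atTop (𝓝 (1 - q)) := hp.const_sub 1
  have hc2 : Tendsto (fun i => (n i : ℝ) * (1 - p i)) atTop atTop := hnR.atTop_mul_pos hq hp'
  -- The expansion is centred at `n p`, whose root is `√n √p`; this rescales `y` by `√q`, and by
  -- `√(1 - q)` for the complementary count.
  have hC1 := tendsto_mul_log_div_sub (k := fun i => (k i : ℝ)) (y := y / √q) hc1 (by
    refine (hy.div hp.sqrt (by positivity)).congr fun i => ?_
    rw [Pi.div_apply, div_div, sqrt_mul (Nat.cast_nonneg _)])
  have hC2 := tendsto_mul_log_div_sub (k := fun i => ((n i - k i : ℕ) : ℝ)) (y := -y / √(1 - q))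
      hc2 (by
    refine (hy.neg.div hp'.sqrt (by positivity)).congr' ?_
    filter_upwards [hcast] with i hi
    rw [Pi.div_apply, sqrt_mul (Nat.cast_nonneg _), ← div_div, hi]
    congr 1
    rw [← neg_div]
    congr 1
    ring)
  have hC := (continuous_exp.tendsto _).comp (hC1.add hC2).neg
  have hfin := (hA.mul hB).mul hC
  have hval : √π / (√π * √π) * (1 / (√2 * √q * √(1 - q)))
      * exp (-((y / √q) ^ 2 / 2 + (-y / √(1 - q)) ^ 2 / 2))
      = 1 / √(2 * π * (q * (1 - q))) * exp (-(y ^ 2 / (2 * (q * (1 - q))))) := by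
    congr 1
    · rw [sqrt_mul (by positivity), sqrt_mul (by positivity), sqrt_mul hq0.le]
      field_simp
    · congr 2
      rw [div_pow, div_pow, sq_sqrt hq0.le, sq_sqrt hq.le]
      field_simp
      ring
  rw [← hval]
  refine hfin.congr' ?_
  filter_upwards [hk0, hkn1, hp.eventually_const_lt hq0, hp.eventually_lt_const hq1, hcast]
    with i h1 h2 h3 h4 h5
  rw [binomWeight_eq_stirling h3 h4 h1 h2]
  simp only [Function.comp, Pi.div_apply]
  -- The two linear terms of the expansions are opposite, so only the logarithms remain.
  have : (k i : ℝ) * log (k i / (n i * p i)) - (k i - n i * p i)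
      + (((n i - k i : ℕ) : ℝ) * log (((n i - k i : ℕ) : ℝ) / (n i * (1 - p i)))
        - (((n i - k i : ℕ) : ℝ) - n i * (1 - p i)))
      = k i * log (k i / (n i * p i))
        + ((n i - k i : ℕ) : ℝ) * log (((n i - k i : ℕ) : ℝ) / (n i * (1 - p i))) := by
    have : ((n i - k i : ℕ) : ℝ) - n i * (1 - p i) = -(k i - n i * p i) := by rw [h5]; ring
    rw [this]
    ring
  rw [this]
  ring

/-! ### The hypergeometric distribution and its local limit. -/

theorem Phg_nonneg (k n l j : ℕ) : 0 ≤ Phg k n l j := by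
  unfold Phg
  split_ifs <;> positivity

theorem sum_range_Phg {n l j : ℕ} (hj : j ≤ n + l) :
    ∑ k ∈ Finset.range (j + 1), Phg k n l j = 1 := by
  have h0 : ((n + l).choose j : ℝ) ≠ 0 := by exact_mod_cast (Nat.choose_pos hj).ne'
  have h1 : ∀ k ∈ Finset.range (j + 1), Phg k n l j
      = (l.choose k * n.choose (j - k) : ℝ) / (n + l).choose j := fun k hk => by
    rw [Phg, if_pos (Nat.lt_succ_iff.1 (Finset.mem_range.1 hk))]
  rw [Finset.sum_congr rfl h1, ← Finset.sum_div, div_eq_one_iff_eq h0, add_comm n l,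
    Nat.add_choose_eq, Finset.Nat.sum_antidiagonal_eq_sum_range_succ
      (fun a b => l.choose a * n.choose b)]
  push_cast
  rfl

theorem sum_Phg_le_sum_range (s : Finset ℕ) (n l j : ℕ) :
    ∑ k ∈ s, Phg k n l j ≤ ∑ k ∈ Finset.range (j + 1), Phg k n l j := by
  have h1 : ∑ k ∈ s, Phg k n l j ≤ ∑ k ∈ s ∪ Finset.range (j + 1), Phg k n l j :=
    Finset.sum_le_sum_of_subset_of_nonneg Finset.subset_union_left
      fun k _ _ => Phg_nonneg k n l j
  refine h1.trans_eq (Finset.sum_subset Finset.subset_union_right fun k _ hk => ?_).symm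
  rw [Phg, if_neg]
  rw [Finset.mem_range] at hk
  omega

theorem sum_Phg_le_one (s : Finset ℕ) {n l j : ℕ} (hj : j ≤ n + l) :
    ∑ k ∈ s, Phg k n l j ≤ 1 :=
  (sum_Phg_le_sum_range s n l j).trans_eq (sum_range_Phg hj)

/-- For independent binomials with a common `p`, conditioning on the total `j` gives the
hypergeometric law. The free `p` is later set to `j / (n + l)`. Where a natural subtraction in an
exponent truncates, a binomial coefficient vanishes on both sides. -/
theorem binomWeight_mul_binomWeight (p : ℝ) {k n l j : ℕ} (hk : k ≤ j) (hj : j ≤ n + l) :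
    binomWeight p l k * binomWeight p n (j - k) = Phg k n l j * binomWeight p (n + l) j := by
  have h0 : ((n + l).choose j : ℝ) ≠ 0 := by exact_mod_cast (Nat.choose_pos hj).ne'
  rw [Phg, if_pos hk]
  unfold binomWeight
  by_cases h1 : k ≤ l
  · by_cases h2 : j - k ≤ n
    · have e1 : p ^ j = p ^ k * p ^ (j - k) := by rw [← pow_add]; congr 1; omega
      have e2 : (1 - p) ^ (n + l - j) = (1 - p) ^ (l - k) * (1 - p) ^ (n - (j - k)) := by
        rw [← pow_add]; congr 1; omega
      rw [e1, e2]
      field_simp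
    · simp [Nat.choose_eq_zero_of_lt (not_le.1 h2)]
  · simp [Nat.choose_eq_zero_of_lt (not_le.1 h1)]

/-- Local limit theorem for the hypergeometric distribution. -/
theorem tendsto_sqrt_mul_Phg {n l j k : ℕ → ℕ} {r q x : ℝ} {v : NNReal} (hr0 : 0 < r) (hr1 : r < 1)
    (hq0 : 0 < q) (hq1 : q < 1) (hv : (v : ℝ) = r * (1 - r) * (q * (1 - q)))
    (hn : Tendsto n atTop atTop)
    (hr : Tendsto (fun i => (n i : ℝ) / ((n i : ℝ) + l i)) atTop (𝓝 r))
    (hq : Tendsto (fun i => (j i : ℝ) / ((n i : ℝ) + l i)) atTop (𝓝 q))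
    (hx : Tendsto (fun i => ((k i : ℝ) - l i * j i / ((n i : ℝ) + l i)) / √((n i : ℝ) + l i))
      atTop (𝓝 x)) :
    Tendsto (fun i => √((n i : ℝ) + l i) * Phg (k i) (n i) (l i) (j i)) atTop
      (𝓝 (gaussianPDFReal 0 v x)) := by
  have hs : 0 < 1 - r := by linarith
  have hq' : 0 < 1 - q := by linarith
  have hnR : Tendsto (fun i => (n i : ℝ)) atTop atTop := tendsto_natCast_atTop_atTop.comp hn
  have hN : Tendsto (fun i => (n i : ℝ) + l i) atTop atTop :=
    tendsto_atTop_mono (fun i => le_add_of_nonneg_right (Nat.cast_nonneg _)) hnR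
  have hNpos : ∀ᶠ i in atTop, (0 : ℝ) < (n i : ℝ) + l i := hN.eventually_gt_atTop 0
  have hl : Tendsto (fun i => (l i : ℝ) / ((n i : ℝ) + l i)) atTop (𝓝 (1 - r)) := by
    refine (hr.const_sub 1).congr' ?_
    filter_upwards [hNpos] with i hi
    field_simp
    ring
  have hlR : Tendsto (fun i => (l i : ℝ)) atTop atTop := by
    refine (hN.atTop_mul_pos hs hl).congr' ?_
    filter_upwards [hNpos] with i hi
    field_simp
  have hlN : Tendsto l atTop atTop := tendsto_natCast_atTop_iff.1 hlR
  have hNN : Tendsto (fun i => n i + l i) atTop atTop := 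
    tendsto_atTop_mono (fun i => Nat.le_add_right _ _) hn
  have hnpos : ∀ᶠ i in atTop, (0 : ℝ) < n i := hnR.eventually_gt_atTop 0
  have hlpos : ∀ᶠ i in atTop, (0 : ℝ) < l i := hlR.eventually_gt_atTop 0
  have hjN : ∀ᶠ i in atTop, j i ≤ n i + l i := by
    filter_upwards [hq.eventually_lt_const hq1, hNpos] with i h1 h2
    rw [div_lt_one h2] at h1
    exact_mod_cast h1.le
  have hsq : Tendsto (fun i => √((n i : ℝ) + l i)) atTop atTop := tendsto_sqrt_atTop.comp hN
  -- The difference `j - k` grows like `r q (n + l)`, so the natural subtraction is eventually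
  -- exact.
  have hkj : ∀ᶠ i in atTop, k i ≤ j i := by
    have h : Tendsto (fun i => ((j i : ℝ) - k i) / ((n i : ℝ) + l i)) atTop (𝓝 (r * q)) := by
      have h := (hr.mul hq).sub (hx.div_atTop hsq)
      rw [sub_zero] at h
      refine h.congr' ?_
      filter_upwards [hNpos] with i hi
      rw [div_div _ √_, mul_self_sqrt hi.le]
      field_simp
      ring
    filter_upwards [h.eventually_const_lt (by positivity : 0 < r * q), hNpos] with i h1 h2
    have : (0 : ℝ) < j i - k i := by
      by_contra hcon
      exact absurd h1 (not_lt.2 (div_nonpos_of_nonpos_of_nonneg (not_lt.1 hcon) h2.le))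
    have : (k i : ℝ) < j i := by linarith
    exact_mod_cast this.le
  have hL := tendsto_sqrt_mul_binomWeight (n := l) (k := k) (y := x / √(1 - r)) hq0 hq1 hlN hq (by
    refine (hx.div hl.sqrt (by positivity)).congr' ?_
    filter_upwards [hNpos] with i hi
    rw [Pi.div_apply, sqrt_div (Nat.cast_nonneg _)]
    have : 0 < √((n i : ℝ) + l i) := by positivity
    field_simp)
  have hR := tendsto_sqrt_mul_binomWeight (n := n) (k := fun i => j i - k i) (y := -x / √r)
    hq0 hq1 hn hq (by
    refine (hx.neg.div hr.sqrt (by positivity)).congr' ?_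
    filter_upwards [hNpos, hkj] with i hi hkji
    rw [Pi.div_apply, sqrt_div (Nat.cast_nonneg _), Nat.cast_sub hkji]
    have : 0 < √((n i : ℝ) + l i) := by positivity
    field_simp
    ring)
  -- With `p = j / (n + l)` the total sits exactly at its mean, hence `y = 0`.
  have hT := tendsto_sqrt_mul_binomWeight (n := fun i => n i + l i) (k := j) (y := 0)
    hq0 hq1 hNN hq (by
    refine tendsto_const_nhds.congr' ?_
    filter_upwards [hNpos] with i hi
    push_cast
    field_simp
    simp)
  have hmain := ((hL.mul hR).div hT (by positivity)).mul
    ((hl.sqrt.mul hr.sqrt).inv₀ (by positivity))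
  -- The exponents combine through `1 / (1 - r) + 1 / r = 1 / (r (1 - r))`.
  have hval : 1 / √(2 * π * (q * (1 - q))) * exp (-((x / √(1 - r)) ^ 2 / (2 * (q * (1 - q))))) *
      (1 / √(2 * π * (q * (1 - q))) * exp (-((-x / √r) ^ 2 / (2 * (q * (1 - q)))))) /
      (1 / √(2 * π * (q * (1 - q))) * exp (-(0 ^ 2 / (2 * (q * (1 - q)))))) *
      (√(1 - r) * √r)⁻¹ = gaussianPDFReal 0 v x := by
    rw [gaussianPDFReal, hv]
    have e1 : 2 * π * (r * (1 - r) * (q * (1 - q))) = (2 * π * (q * (1 - q))) * ((1 - r) * r) := by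
      ring
    have e2 : rexp (-(x - 0) ^ 2 / (2 * (r * (1 - r) * (q * (1 - q)))))
        = exp (-((x / √(1 - r)) ^ 2 / (2 * (q * (1 - q))))) *
          exp (-((-x / √r) ^ 2 / (2 * (q * (1 - q))))) := by
      rw [← exp_add]
      congr 1
      rw [div_pow, div_pow, sq_sqrt hs.le, sq_sqrt hr0.le]
      field_simp
      ring
    rw [e1, e2, sqrt_mul (by positivity : 0 ≤ 2 * π * (q * (1 - q))), sqrt_mul hs.le]
    have e3 : rexp (-(0 ^ 2 / (2 * (q * (1 - q))))) = 1 := by simp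
    rw [e3]
    field_simp
  rw [← hval]
  refine hmain.congr' ?_
  filter_upwards [hNpos, hnpos, hlpos, hjN, hkj, hq.eventually_const_lt hq0,
    hq.eventually_lt_const hq1] with i h1 h2 h3 h4 h5 h6 h7
  have hw : 0 < binomWeight ((j i : ℝ) / ((n i : ℝ) + l i)) (n i + l i) (j i) := by
    have : (0 : ℝ) < (n i + l i).choose (j i) := by exact_mod_cast Nat.choose_pos h4
    have : 0 < 1 - (j i : ℝ) / ((n i : ℝ) + l i) := by linarith
    unfold binomWeight
    positivity
  have key := binomWeight_mul_binomWeight ((j i : ℝ) / ((n i : ℝ) + l i)) h5 h4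
  rw [Pi.div_apply, sqrt_div (Nat.cast_nonneg _), sqrt_div (Nat.cast_nonneg _), mul_mul_mul_comm,
    key]
  push_cast
  have := sq_sqrt h1.le
  generalize binomWeight _ (n i + l i) (j i) = W at *
  have : 0 < √((n i : ℝ) + l i) := by positivity
  field_simp

/-! ### From local limits to limits of sums. -/

/-- Riemann sums of `g` over the grid `(k - m i) / s i` are asymptotically bounded below by the
integral, by Fatou's lemma. -/
theorem setLIntegral_le_liminf_sum {w : ℕ → ℕ → ℝ} {m s : ℕ → ℝ} {g : ℝ → ℝ} {A : Set ℝ}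
    {J : ℕ → Finset ℕ} (hA : IsOpen A) (hw : ∀ i k, 0 ≤ w i k)
    (hs : Tendsto s atTop atTop) (hm : ∀ y, Tendsto (fun i => m i + y * s i) atTop atTop)
    (hg : ∀ (k : ℕ → ℕ) (y : ℝ), Tendsto (fun i => ((k i : ℝ) - m i) / s i) atTop (𝓝 y) →
      Tendsto (fun i => s i * w i (k i)) atTop (𝓝 (g y)))
    (hJ : ∀ᶠ i in atTop, ∀ k : ℕ, ((k : ℝ) - m i) / s i ∈ A → w i k ≠ 0 → k ∈ J i) :
    ∫⁻ y in A, ENNReal.ofReal (g y) ≤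
      liminf (fun i => ENNReal.ofReal (∑ k ∈ J i, w i k)) atTop := by
  -- A histogram: cells of width `1 / s` and height `s w`, so its integral is the sum of the weights
  -- over `J`.
  set G : ℕ → ℝ → ENNReal := fun i y => ∑ k ∈ J i,
    (Set.Ico (((k : ℝ) - m i) / s i) (((k : ℝ) + 1 - m i) / s i)).indicator
      (fun _ => ENNReal.ofReal (s i * w i k)) y with hG
  have hGm : ∀ i, Measurable (G i) := fun i =>
    Finset.measurable_sum _ fun k _ => measurable_const.indicator measurableSet_Ico
  have hpt : ∀ y ∈ A, ENNReal.ofReal (g y) ≤ liminf (fun i => G i y) atTop := by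
    intro y hy
    -- The index of the cell containing `y`. Its left endpoint tends to `y`, hence eventually lies
    -- in the open set `A`.
    set k : ℕ → ℕ := fun i => ⌊m i + y * s i⌋₊ with hk
    have hfl : ∀ᶠ i in atTop, (k i : ℝ) ≤ m i + y * s i ∧ m i + y * s i < k i + 1 := by
      filter_upwards [(hm y).eventually_ge_atTop 0] with i hi
      exact ⟨Nat.floor_le hi, Nat.lt_floor_add_one _⟩
    have hspos := hs.eventually_gt_atTop 0
    have hky : Tendsto (fun i => ((k i : ℝ) - m i) / s i) atTop (𝓝 y) := by
      have h1 : Tendsto (fun i => y - 1 / s i) atTop (𝓝 y) := by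
        simpa using 
          (tendsto_const_nhds.div_atTop hs : Tendsto (fun i => 1 / s i) atTop (𝓝 0)).const_sub y
      refine tendsto_of_tendsto_of_tendsto_of_le_of_le' h1 tendsto_const_nhds ?_ ?_
      · filter_upwards [hfl, hspos] with i hi hsi
        rw [le_div_iff₀ hsi, sub_mul, one_div_mul_cancel hsi.ne']
        linarith
      · filter_upwards [hfl, hspos] with i hi hsi
        rw [div_le_iff₀ hsi]
        linarith
    have hlim := ENNReal.tendsto_ofReal (hg k y hky)
    rw [← hlim.liminf_eq]
    refine liminf_le_liminf ?_
    filter_upwards [hfl, hspos, hJ, hky.eventually_mem (hA.mem_nhds hy)] with i hi hsi hJi hkA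
    rcases eq_or_ne (w i (k i)) 0 with hw0 | hw0
    · rw [hw0, mul_zero, ENNReal.ofReal_zero]
      exact zero_le
    have hmem : k i ∈ J i := hJi _ hkA hw0
    have hyI : y ∈ Set.Ico (((k i : ℝ) - m i) / s i) (((k i : ℝ) + 1 - m i) / s i) := by
      refine ⟨?_, ?_⟩
      · rw [div_le_iff₀ hsi]; linarith
      · rw [lt_div_iff₀ hsi]; linarith
    refine le_trans ?_ (Finset.single_le_sum (f := fun k : ℕ =>
      (Set.Ico (((k : ℝ) - m i) / s i) (((k : ℝ) + 1 - m i) / s i)).indicator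
      (fun _ => ENNReal.ofReal (s i * w i k)) y) (fun _ _ => zero_le) hmem)
    simp only [Set.indicator_of_mem hyI, le_refl]
  calc ∫⁻ y in A, ENNReal.ofReal (g y) ≤ ∫⁻ y in A, liminf (fun i => G i y) atTop :=
        setLIntegral_mono' hA.measurableSet hpt
    _ ≤ liminf (fun i => ∫⁻ y in A, G i y) atTop := lintegral_liminf_le hGm
    _ ≤ _ := by
        refine liminf_le_liminf ?_
        filter_upwards [hs.eventually_gt_atTop 0] with i hsi
        refine (setLIntegral_le_lintegral _ _).trans ?_
        rw [hG, lintegral_finsetSum _ fun k _ => measurable_const.indicator measurableSet_Ico,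
          ENNReal.ofReal_sum_of_nonneg fun k _ => hw i k]
        refine Finset.sum_le_sum fun k _ => ?_
        rw [lintegral_indicator_const measurableSet_Ico, Real.volume_Ico,
          ← ENNReal.ofReal_mul (mul_nonneg hsi.le (hw i k))]
        refine ENNReal.ofReal_le_ofReal (le_of_eq ?_)
        field_simp
        ring

section CentralLimit

variable {n l j : ℕ → ℕ} {r q : ℝ} {v : NNReal}

theorem eventually_lt_sum_Phg (hr0 : 0 < r) (hr1 : r < 1)
    (hq0 : 0 < q) (hq1 : q < 1) (hv : (v : ℝ) = r * (1 - r) * (q * (1 - q)))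
    (hn : Tendsto n atTop atTop)
    (hr : Tendsto (fun i => (n i : ℝ) / ((n i : ℝ) + l i)) atTop (𝓝 r))
    (hq : Tendsto (fun i => (j i : ℝ) / ((n i : ℝ) + l i)) atTop (𝓝 q))
    {A : Set ℝ} {J : ℕ → Finset ℕ} (hA : IsOpen A)
    (hJ : ∀ᶠ i in atTop, ∀ k : ℕ,
      ((k : ℝ) - l i * j i / ((n i : ℝ) + l i)) / √((n i : ℝ) + l i) ∈ A →
        k ≤ j i → k ∈ J i)
    {c : ℝ} (hc : c < (gaussianReal 0 v).real A) :
    ∀ᶠ i in atTop, c < ∑ k ∈ J i, Phg k (n i) (l i) (j i) := by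
  have hs : 0 < 1 - r := by linarith
  have hq' : 0 < 1 - q := by linarith
  have hnR : Tendsto (fun i => (n i : ℝ)) atTop atTop := tendsto_natCast_atTop_atTop.comp hn
  have hN : Tendsto (fun i => (n i : ℝ) + l i) atTop atTop :=
    tendsto_atTop_mono (fun i => le_add_of_nonneg_right (Nat.cast_nonneg _)) hnR
  have hNpos : ∀ᶠ i in atTop, (0 : ℝ) < (n i : ℝ) + l i := hN.eventually_gt_atTop 0
  have hl : Tendsto (fun i => (l i : ℝ) / ((n i : ℝ) + l i)) atTop (𝓝 (1 - r)) := by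
    refine (hr.const_sub 1).congr' ?_
    filter_upwards [hNpos] with i hi
    field_simp
    ring
  have hsq : Tendsto (fun i => √((n i : ℝ) + l i)) atTop atTop := tendsto_sqrt_atTop.comp hN
  have hm : ∀ y : ℝ, Tendsto (fun i => l i * j i / ((n i : ℝ) + l i) + y * √((n i : ℝ) + l i))
      atTop atTop := fun y => by
    have h := (hl.mul hq).add (tendsto_const_nhds (x := y) |>.div_atTop hsq)
    rw [add_zero] at h
    refine (hN.atTop_mul_pos (by positivity : 0 < (1 - r) * q) h).congr' ?_
    filter_upwards [hNpos] with i hi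
    rw [mul_add]
    congr 1
    · field_simp
    · rw [mul_div_assoc', mul_comm _ y, mul_div_assoc, div_sqrt]
  have hv0 : v ≠ 0 := by
    rintro rfl
    have : 0 < r * (1 - r) * (q * (1 - q)) := by positivity
    rw [← hv] at this
    simp at this
  have hF := setLIntegral_le_liminf_sum (w := fun i k => Phg k (n i) (l i) (j i)) hA
    (fun i k => Phg_nonneg _ _ _ _) hsq hm
    (fun k y hy => tendsto_sqrt_mul_Phg hr0 hr1 hq0 hq1 hv hn hr hq hy) (by
      filter_upwards [hJ] with i hi k hk hw
      refine hi k hk (not_lt.1 fun hlt => hw ?_)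
      rw [Phg, if_neg (not_le.2 hlt)])
  -- `ENNReal.ofReal` sends negative `c` to `0`, so strictness could fail there; for such `c`
  -- nonnegativity of the sum is enough.
  have hG : ENNReal.ofReal c < (gaussianReal 0 v) A ∨ c < 0 := by
    rcases lt_or_ge c 0 with h | h
    · exact Or.inr h
    · left
      rw [← ofReal_measureReal]
      exact (ENNReal.ofReal_lt_ofReal_iff_of_nonneg h).2 hc
  rcases hG with hG | hneg
  · rw [gaussianReal_apply 0 hv0] at hG
    have := eventually_lt_of_lt_liminf (hG.trans_le hF)
    filter_upwards [this] with i hi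
    exact (ENNReal.ofReal_lt_ofReal_iff'.1 hi).1
  · exact Eventually.of_forall fun i =>
      hneg.trans_le (Finset.sum_nonneg fun k _ => Phg_nonneg _ _ _ _)

/-- The complement of `J` captures `A`, so the lower bound on `A` and total mass at most one bound
the mass of `J`. -/
theorem eventually_sum_Phg_lt (hr0 : 0 < r) (hr1 : r < 1)
    (hq0 : 0 < q) (hq1 : q < 1) (hv : (v : ℝ) = r * (1 - r) * (q * (1 - q)))
    (hn : Tendsto n atTop atTop)
    (hr : Tendsto (fun i => (n i : ℝ) / ((n i : ℝ) + l i)) atTop (𝓝 r))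
    (hq : Tendsto (fun i => (j i : ℝ) / ((n i : ℝ) + l i)) atTop (𝓝 q))
    (hj : ∀ i, j i ≤ n i + l i)
    {A : Set ℝ} {J : ℕ → Finset ℕ} (hA : IsOpen A)
    (hJ : ∀ᶠ i in atTop, ∀ k ∈ J i,
      ((k : ℝ) - l i * j i / ((n i : ℝ) + l i)) / √((n i : ℝ) + l i) ∉ A)
    {c : ℝ} (hc : 1 - (gaussianReal 0 v).real A < c) :
    ∀ᶠ i in atTop, ∑ k ∈ J i, Phg k (n i) (l i) (j i) < c := by
  have h1 : ∀ᶠ i in atTop, 1 - c < ∑ k ∈ Finset.range (n i + l i + 1) \ J i,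
      Phg k (n i) (l i) (j i) := by
    refine eventually_lt_sum_Phg hr0 hr1 hq0 hq1 hv hn hr hq hA ?_ (by linarith)
    filter_upwards [hJ] with i hi k hk hkj
    rw [Finset.mem_sdiff, Finset.mem_range]
    exact ⟨by have := hj i; omega, fun hmem => hi k hmem hk⟩
  filter_upwards [h1] with i hi
  have h2 := sum_Phg_le_one (J i ∪ (Finset.range (n i + l i + 1) \ J i)) (hj i)
  rw [Finset.sum_union Finset.disjoint_sdiff] at h2
  linarith

end CentralLimit

/-! ### The normal distribution function. -/

theorem Phi_eq_real (x : ℝ) : Phi x = (gaussianReal 0 1).real (Set.Iic x) := cdf_eq_real _ x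

theorem gaussianReal_real_Iic {v : NNReal} {σ : ℝ} (hσ : 0 < σ) (hv : (v : ℝ) = σ ^ 2) (x : ℝ) :
    (gaussianReal 0 v).real (Set.Iic x) = Phi (x / σ) := by
  have h := gaussianReal_map_const_mul (μ := 0) (v := 1) σ
  have hv' : NNReal.mk (σ ^ 2) (sq_nonneg σ) * 1 = v := by
    rw [mul_one]; exact NNReal.eq hv.symm
  rw [hv', mul_zero] at h
  rw [← h, Phi_eq_real, measureReal_def, measureReal_def,
    Measure.map_apply (measurable_const_mul σ) measurableSet_Iic]
  congr 2
  ext y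
  simp only [Set.mem_preimage, Set.mem_Iic]
  rw [le_div_iff₀ hσ, mul_comm]

theorem continuous_Phi : Continuous Phi := by
  have := nullSingletonClass_gaussianReal (μ := 0) (v := 1) one_ne_zero
  have h : Phi = fun x => (∫ t in (0 : ℝ)..x, gaussianPDFReal 0 1 t)
      + ∫ t in Set.Iic 0, gaussianPDFReal 0 1 t := by
    funext x
    have hint := integrable_gaussianPDFReal 0 1
    rw [Phi_eq_real, measureReal_def, gaussianReal_apply_eq_integral 0 one_ne_zero,
      ENNReal.toReal_ofReal (integral_nonneg fun t => gaussianPDFReal_nonneg 0 1 t),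
      ← intervalIntegral.integral_Iic_sub_Iic hint.integrableOn hint.integrableOn]
    ring
  rw [h]
  exact (intervalIntegral.continuous_primitive
    (fun a b => (integrable_gaussianPDFReal 0 1).intervalIntegrable) 0).add continuous_const

theorem tendsto_Phi_atBot : Tendsto Phi atBot (𝓝 0) := tendsto_cdf_atBot _

theorem Phi_nonneg (x : ℝ) : 0 ≤ Phi x := cdf_nonneg _ x

/-! ### Binary entropy and the two regimes of `f`. -/

theorem continuous_h : Continuous h := by
  unfold h
  exact binEntropy_continuous.div_const _

theorem hBar_nonneg {x : ℝ} (hx : 0 ≤ x) : 0 ≤ hBar x := by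
  unfold hBar h
  split_ifs with hlt
  · exact div_nonneg (binEntropy_nonneg hx (by linarith)) (log_nonneg one_le_two)
  · exact zero_le_one

theorem hBar_le_one (x : ℝ) : hBar x ≤ 1 := by
  unfold hBar h
  split_ifs
  · rw [div_le_one (log_pos one_lt_two)]
    exact binEntropy_le_log_two
  · exact le_rfl

/-- A lower bound for the slope of `h` on `[0, m]`, valid for `m < 1 / 2`. -/
noncomputable def hSlope (m : ℝ) : ℝ := (log (1 - m) - log m) / log 2

theorem hSlope_pos {m : ℝ} (hm0 : 0 < m) (hm : m < 1 / 2) : 0 < hSlope m :=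
  div_pos (sub_pos.2 (log_lt_log hm0 (by linarith))) (log_pos one_lt_two)

/-- The derivative `log (1 - x) - log x` decreases, so its least value on `(0, m]` is at `m`. -/
theorem hSlope_mul_sub_le {m a b : ℝ} (hm0 : 0 < m) (hm : m < 1 / 2) (ha : 0 ≤ a) (hab : a ≤ b)
    (hb : b ≤ m) : hSlope m * (b - a) ≤ h b - h a := by
  have hlog : 0 < log 2 := log_pos one_lt_two
  have key := (convex_Icc (0 : ℝ) m).mul_sub_le_image_sub_of_le_deriv
    (f := binEntropy) (C := log (1 - m) - log m) binEntropy_continuous.continuousOn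
    (fun x hx => by
      rw [interior_Icc] at hx
      exact (differentiableAt_binEntropy hx.1.ne' (by linarith [hx.2])).differentiableWithinAt)
    (fun x hx => by
      rw [interior_Icc] at hx
      rw [deriv_binEntropy]
      have h1 : log (1 - m) ≤ log (1 - x) := log_le_log (by linarith) (by linarith [hx.2])
      have h2 : log x ≤ log m := log_le_log hx.1 hx.2.le
      linarith)
    a ⟨ha, hab.trans hb⟩ b ⟨ha.trans hab, hb⟩ hab
  unfold hSlope h
  rw [← sub_div, div_mul_eq_mul_div]
  gcongr

theorem f_nonneg (k' k n l : ℕ) (δ : ℝ) : 0 ≤ f k' k n l δ := by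
  unfold f
  split_ifs
  · exact le_min (rpow_nonneg zero_le_two _) zero_le_one
  · exact zero_le_one

theorem f_le_one (k' k n l : ℕ) (δ : ℝ) : f k' k n l δ ≤ 1 := by
  unfold f
  split_ifs
  · exact min_le_right _ _
  · exact le_rfl

/-- Turns a gap between the rates into exponential decay; a gap of order `1 / √n` already forces `f
→ 0`. -/
theorem f_le_rpow {k' k n l : ℕ} {δ m : ℝ} (hn : 0 < n) (hm0 : 0 < m) (hm : m < 1 / 2)
    (h1 : (k' : ℝ) / n ≤ k / l + δ) (h2 : (k : ℝ) / l + δ ≤ m) :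
    f k' k n l δ ≤ (2 : ℝ) ^ (-(n * (hSlope m * (k / l + δ - k' / n)))) := by
  have hnR : (0 : ℝ) < n := by positivity
  have hlt : (k' : ℝ) < n / 2 := by
    have : (k' : ℝ) / n < 1 / 2 := by linarith
    rw [div_lt_iff₀ hnR] at this
    linarith
  have hs := hSlope_mul_sub_le hm0 hm (by positivity) h1 h2
  rw [f, if_pos hlt]
  refine (min_le_left _ _).trans (rpow_le_rpow_of_exponent_le one_le_two ?_)
  rw [← mul_neg]
  gcongr
  linarith

/-- Entropy increases on `[0, 1/2]`, so the exponent is nonnegative and the minimum is `1`. -/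
theorem f_eq_one {k' k n l : ℕ} {δ : ℝ} (h0 : 0 ≤ (k : ℝ) / l + δ)
    (h1 : (k : ℝ) / l + δ ≤ (k' : ℝ) / n) : f k' k n l δ = 1 := by
  unfold f
  split_ifs with hlt
  · refine min_eq_right (one_le_rpow one_le_two (mul_nonneg (Nat.cast_nonneg _) (sub_nonneg.2 ?_)))
    have hk : (k' : ℝ) / n ≤ 2⁻¹ := by
      rcases Nat.eq_zero_or_pos n with rfl | hn
      · simp
      · rw [div_le_iff₀ (by positivity)]
        linarith
    unfold h
    exact div_le_div_of_nonneg_right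
      (binEntropy_strictMonoOn.monotoneOn ⟨h0, h1.trans hk⟩ ⟨h0.trans h1, hk⟩ h1)
      (log_nonneg one_le_two)
  · rfl

/-! ### Bounds for the error sum at fixed sizes. -/

/-- Using `max k kL` treats both sums at once; the deviation keeps the index `k`. -/
theorem errSum_eq_sum_range (δ : ℕ → ℝ) {n l kL kU : ℕ} (hk : kL ≤ kU) (j : ℕ) :
    errSum δ n l kL kU j = ∑ k ∈ Finset.range (kU + 1),
      Phg k n l j * f (j - max k kL) (max k kL) n l (δ k) := by
  have hsplit : Finset.range (kU + 1) = Finset.range (kL + 1) ∪ Finset.Ioc kL kU := by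
    ext k
    simp only [Finset.mem_range, Finset.mem_union, Finset.mem_Ioc]
    omega
  have hdisj : Disjoint (Finset.range (kL + 1)) (Finset.Ioc kL kU) := by
    rw [Finset.disjoint_left]
    intro k
    simp only [Finset.mem_range, Finset.mem_Ioc]
    omega
  rw [hsplit, Finset.sum_union hdisj, errSum]
  congr 1
  · refine Finset.sum_congr rfl fun k hk => ?_
    rw [max_eq_right (Nat.lt_succ_iff.1 (Finset.mem_range.1 hk))]
  · refine Finset.sum_congr rfl fun k hk => ?_
    rw [max_eq_left (Finset.mem_Ioc.1 hk).1.le]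

theorem errSum_nonneg (δ : ℕ → ℝ) (n l kL kU j : ℕ) : 0 ≤ errSum δ n l kL kU j :=
  add_nonneg (Finset.sum_nonneg fun _ _ => mul_nonneg (Phg_nonneg _ _ _ _) (f_nonneg _ _ _ _ _))
    (Finset.sum_nonneg fun _ _ => mul_nonneg (Phg_nonneg _ _ _ _) (f_nonneg _ _ _ _ _))

/-- If `f ≤ η` outside `J`, then the error sum is at most the mass of `J` plus `η`. -/
theorem errSum_le_sum_add {δ : ℕ → ℝ} {n l kL kU j : ℕ} (hk : kL ≤ kU) (hj : j ≤ n + l) {η : ℝ}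
    (J : Finset ℕ) (hη : 0 ≤ η)
    (hf : ∀ k ≤ kU, k ∉ J → f (j - max k kL) (max k kL) n l (δ k) ≤ η) :
    errSum δ n l kL kU j ≤ ∑ k ∈ J, Phg k n l j + η := by
  rw [errSum_eq_sum_range δ hk, ← Finset.sum_filter_add_sum_filter_not _ (· ∈ J)]
  refine add_le_add ?_ ?_
  · refine (Finset.sum_le_sum fun k _ => mul_le_of_le_one_right (Phg_nonneg _ _ _ _)
      (f_le_one _ _ _ _ _)).trans ?_
    refine Finset.sum_le_sum_of_subset_of_nonneg (fun k hk => ?_) fun _ _ _ => Phg_nonneg _ _ _ _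
    exact (Finset.mem_filter.1 hk).2
  · refine (Finset.sum_le_sum (g := fun k => Phg k n l j * η) fun k hk => ?_).trans ?_
    · have := Finset.mem_filter.1 hk
      exact mul_le_mul_of_nonneg_left
        (hf k (Nat.lt_succ_iff.1 (Finset.mem_range.1 this.1)) this.2) (Phg_nonneg _ _ _ _)
    · rw [← Finset.sum_mul]
      exact mul_le_of_le_one_left hη (sum_Phg_le_one _ hj)

theorem sum_Phg_le_errSum {δ : ℕ → ℝ} {n l kL kU j : ℕ} (hk : kL ≤ kU) (J : Finset ℕ)
    (hJ : J ⊆ Finset.range (kU + 1))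
    (hf : ∀ k ∈ J, k ≤ j → f (j - max k kL) (max k kL) n l (δ k) = 1) :
    ∑ k ∈ J, Phg k n l j ≤ errSum δ n l kL kU j := by
  rw [errSum_eq_sum_range δ hk]
  refine le_trans (Finset.sum_le_sum fun k hk => ?_)
    (Finset.sum_le_sum_of_subset_of_nonneg hJ fun k _ _ =>
      mul_nonneg (Phg_nonneg _ _ _ _) (f_nonneg _ _ _ _ _))
  by_cases hkj : k ≤ j
  · rw [hf k hk hkj, mul_one]
  · rw [Phg, if_neg hkj, zero_mul]

/-- Markov's inequality for the number of sampled elements that are not drawn. -/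
theorem mul_sum_Phg_le {n l j kU : ℕ} (hl : 0 < l) (hj : j ≤ n + l) (hkU : kU ≤ l) :
    ((l : ℝ) - kU) * ∑ k ∈ Finset.range (kU + 1), Phg k n l j
      ≤ l * (1 - j / ((n : ℝ) + l)) := by
  obtain ⟨m, rfl⟩ : ∃ m, l = m + 1 := ⟨l - 1, by omega⟩
  have hC : (0 : ℝ) < (n + (m + 1)).choose j := by exact_mod_cast Nat.choose_pos hj
  have hT : (0 : ℝ) < (n : ℝ) + (m + 1 : ℕ) := by positivity
  -- The identity `(l - k) C(l, k) = l C(l - 1, k)` leaves a Vandermonde sum for a sample smaller by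
  -- one.
  have hterm : ∀ k ∈ Finset.range (kU + 1), (((m + 1 : ℕ) : ℝ) - kU) * Phg k n (m + 1) j
      ≤ ((m + 1 : ℕ) : ℝ) / (n + (m + 1)).choose j *
        (if k ≤ j then (m.choose k * n.choose (j - k) : ℝ) else 0) := by
    intro k hk
    have hk' : k ≤ kU := Nat.lt_succ_iff.1 (Finset.mem_range.1 hk)
    have h1 : (m.choose k : ℝ) * (m + 1 : ℕ) = (m + 1).choose k * (((m + 1 : ℕ) : ℝ) - k) := by
      have := Nat.choose_mul_succ_eq m k
      rw [← Nat.cast_sub (by omega : k ≤ m + 1)]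
      exact_mod_cast this
    unfold Phg
    split_ifs with hkj
    · rw [mul_div_assoc', div_mul_eq_mul_div]
      refine div_le_div_of_nonneg_right ?_ hC.le
      have h2 : ((m + 1 : ℕ) : ℝ) * (m.choose k * n.choose (j - k))
          = (((m + 1 : ℕ) : ℝ) - k) * ((m + 1).choose k * n.choose (j - k)) := by
        linear_combination (n.choose (j - k) : ℝ) * h1
      rw [h2]
      gcongr
    · simp
  have hsum : ∑ k ∈ Finset.range (kU + 1),
      (if k ≤ j then (m.choose k * n.choose (j - k) : ℝ) else 0) ≤ (n + m).choose j := by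
    have hle : ∑ k ∈ Finset.range (kU + 1),
        (if k ≤ j then (m.choose k * n.choose (j - k) : ℝ) else 0)
        ≤ ∑ k ∈ Finset.range (j + 1), (m.choose k * n.choose (j - k) : ℝ) := by
      rw [← Finset.sum_filter]
      refine Finset.sum_le_sum_of_subset_of_nonneg (fun k hk => ?_) fun _ _ _ => by positivity
      rw [Finset.mem_range, Nat.lt_succ_iff]
      exact (Finset.mem_filter.1 hk).2
    refine hle.trans_eq ?_
    rw [add_comm n m, Nat.add_choose_eq, Finset.Nat.sum_antidiagonal_eq_sum_range_succ
      (fun a b => m.choose a * n.choose b)]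
    push_cast
    rfl
  have hchoose : ((n + m).choose j : ℝ) * ((n : ℝ) + (m + 1 : ℕ))
      = (n + (m + 1)).choose j * ((n : ℝ) + (m + 1 : ℕ) - j) := by
    have := Nat.choose_mul_succ_eq (n + m) j
    have h2 : ((n : ℝ) + (m + 1 : ℕ) - j) = ((n + m + 1 - j : ℕ) : ℝ) := by
      rw [Nat.cast_sub (by omega)]; push_cast; ring
    rw [h2]
    exact_mod_cast this
  rw [Finset.mul_sum]
  refine (Finset.sum_le_sum hterm).trans ?_
  rw [← Finset.mul_sum]
  calc _ ≤ ((m + 1 : ℕ) : ℝ) / (n + (m + 1)).choose j * (n + m).choose j := by gcongr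
    _ = _ := by
      rw [div_mul_eq_mul_div, div_eq_iff hC.ne']
      have : ((n + m).choose j : ℝ) = (n + (m + 1)).choose j * (1 - j / ((n : ℝ) + (m + 1 : ℕ))) := by
        field_simp
        linarith [hchoose]
      rw [this]
      ring

/-! ### The asymptotic regime, and error rates outside `[pL, pU]`. -/

/-- Sample sizes and error thresholds with the asymptotics of the Gaussian approximation. -/
structure Regime (pL pU r : ℝ) (n l kL kU : ℕ → ℕ) : Prop where
  pL_pos : 0 < pL
  pL_lt : pL < pU
  pU_lt : pU < 1 / 2
  r_pos : 0 < r
  r_lt : r < 1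
  tendsto_n : Tendsto n atTop atTop
  tendsto_ratio : Tendsto (fun i => (n i : ℝ) / ((n i : ℝ) + l i)) atTop (𝓝 r)
  tendsto_kL : Tendsto (fun i => (kL i : ℝ) / l i) atTop (𝓝 pL)
  tendsto_kU : Tendsto (fun i => (kU i : ℝ) / l i) atTop (𝓝 pU)

/-- The deviation `δ_k = ε (k / l) / √(n + l)`. -/
noncomputable def scaledDev (ε : ℝ → ℝ) (n l k : ℕ) : ℝ := ε (k / l) / √((n : ℝ) + l)

namespace Regime

variable {pL pU r : ℝ} {n l kL kU : ℕ → ℕ}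

theorem comp (H : Regime pL pU r n l kL kU) {φ : ℕ → ℕ} (hφ : StrictMono φ) :
    Regime pL pU r (n ∘ φ) (l ∘ φ) (kL ∘ φ) (kU ∘ φ) where
  pL_pos := H.pL_pos
  pL_lt := H.pL_lt
  pU_lt := H.pU_lt
  r_pos := H.r_pos
  r_lt := H.r_lt
  tendsto_n := H.tendsto_n.comp hφ.tendsto_atTop
  tendsto_ratio := H.tendsto_ratio.comp hφ.tendsto_atTop
  tendsto_kL := H.tendsto_kL.comp hφ.tendsto_atTop
  tendsto_kU := H.tendsto_kU.comp hφ.tendsto_atTop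

theorem one_sub_r_pos (H : Regime pL pU r n l kL kU) : 0 < 1 - r := by linarith [H.r_lt]

theorem tendsto_nR (H : Regime pL pU r n l kL kU) : Tendsto (fun i => (n i : ℝ)) atTop atTop :=
  tendsto_natCast_atTop_atTop.comp H.tendsto_n

theorem tendsto_total (H : Regime pL pU r n l kL kU) :
    Tendsto (fun i => (n i : ℝ) + l i) atTop atTop :=
  tendsto_atTop_mono (fun _ => le_add_of_nonneg_right (Nat.cast_nonneg _)) H.tendsto_nR

theorem tendsto_sqrt_total (H : Regime pL pU r n l kL kU) :
    Tendsto (fun i => √((n i : ℝ) + l i)) atTop atTop := tendsto_sqrt_atTop.comp H.tendsto_total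

theorem tendsto_l_ratio (H : Regime pL pU r n l kL kU) :
    Tendsto (fun i => (l i : ℝ) / ((n i : ℝ) + l i)) atTop (𝓝 (1 - r)) := by
  refine (H.tendsto_ratio.const_sub 1).congr' ?_
  filter_upwards [H.tendsto_total.eventually_gt_atTop 0] with i hi
  field_simp
  ring

theorem tendsto_lR (H : Regime pL pU r n l kL kU) : Tendsto (fun i => (l i : ℝ)) atTop atTop := by
  refine (H.tendsto_total.atTop_mul_pos H.one_sub_r_pos H.tendsto_l_ratio).congr' ?_
  filter_upwards [H.tendsto_total.eventually_gt_atTop 0] with i hi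
  field_simp

theorem eventually_pos (H : Regime pL pU r n l kL kU) : ∀ᶠ i in atTop, 0 < n i ∧ 0 < l i := by
  filter_upwards [H.tendsto_n.eventually_gt_atTop 0, H.tendsto_lR.eventually_gt_atTop 0]
    with i h1 h2
  exact ⟨h1, by exact_mod_cast h2⟩

theorem eventually_kL_lt_kU (H : Regime pL pU r n l kL kU) : ∀ᶠ i in atTop, kL i < kU i := by
  filter_upwards [H.tendsto_kL.eventually_lt H.tendsto_kU H.pL_lt, H.eventually_pos] with i h1 h2
  have h3 : (0 : ℝ) < l i := by exact_mod_cast h2.2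
  rw [div_lt_div_iff_of_pos_right h3] at h1
  exact_mod_cast h1

theorem tendsto_sqrt_div_l (H : Regime pL pU r n l kL kU) :
    Tendsto (fun i => √((n i : ℝ) + l i) / l i) atTop (𝓝 0) := by
  have h := (H.tendsto_l_ratio.inv₀ H.one_sub_r_pos.ne').div_atTop H.tendsto_sqrt_total
  refine h.congr' ?_
  filter_upwards [H.tendsto_total.eventually_gt_atTop 0] with i hi
  rw [inv_div, div_div, mul_comm (l i : ℝ), ← div_div, div_sqrt]

theorem tendsto_sq_total_div (H : Regime pL pU r n l kL kU) :
    Tendsto (fun i => ((n i : ℝ) + l i) ^ 2 / (n i * l i)) atTop (𝓝 (1 / (r * (1 - r)))) := by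
  have h := (H.tendsto_ratio.mul H.tendsto_l_ratio).inv₀ (mul_pos H.r_pos H.one_sub_r_pos).ne'
  rw [one_div]
  refine h.congr fun i => ?_
  rw [div_mul_div_comm, inv_div, sq]

theorem tendsto_n_div_sqrt (H : Regime pL pU r n l kL kU) :
    Tendsto (fun i => (n i : ℝ) / √((n i : ℝ) + l i)) atTop atTop := by
  refine (H.tendsto_sqrt_total.atTop_mul_pos H.r_pos H.tendsto_ratio).congr' ?_
  filter_upwards [H.tendsto_total.eventually_gt_atTop 0] with i hi
  rw [mul_div_assoc', mul_comm, mul_div_assoc, sqrt_div_self, div_eq_mul_inv (n i : ℝ) √_]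

theorem tendsto_const_div_sqrt (H : Regime pL pU r n l kL kU) (c : ℝ) :
    Tendsto (fun i => c / √((n i : ℝ) + l i)) atTop (𝓝 0) :=
  tendsto_const_nhds.div_atTop H.tendsto_sqrt_total

theorem eventually_ratio_mem (H : Regime pL pU r n l kL kU) :
    ∀ᶠ i in atTop, ∀ k ≤ kU i, (k : ℝ) / l i ∈ Set.Icc (0 : ℝ) 1 := by
  have h1 : pU < 1 := by linarith [H.pU_lt]
  filter_upwards [H.tendsto_kU.eventually_lt_const h1, H.eventually_pos] with i hi hpos k hk
  have : (0 : ℝ) < l i := by exact_mod_cast hpos.2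
  refine ⟨by positivity, ?_⟩
  have : (k : ℝ) / l i ≤ kU i / l i := by gcongr
  linarith

theorem eventually_abs_scaledDev_le (H : Regime pL pU r n l kL kU) {ε : ℝ → ℝ} {C : ℝ}
    (hC : ∀ x ∈ Set.Icc (0 : ℝ) 1, |ε x| ≤ C) :
    ∀ᶠ i in atTop, ∀ k ≤ kU i, |scaledDev ε (n i) (l i) k| ≤ C / √((n i : ℝ) + l i) := by
  filter_upwards [H.eventually_ratio_mem] with i hi k hk
  rw [scaledDev, abs_div, abs_of_nonneg (sqrt_nonneg _)]
  exact div_le_div_of_nonneg_right (hC _ (hi k hk)) (sqrt_nonneg _)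

/-- `f` is uniformly small when the error rate on the key stays below the tolerated one by a
margin of order `1 / √(n + l)`. -/
theorem eventually_f_le (H : Regime pL pU r n l kL kU) {ε : ℝ → ℝ} {C : ℝ}
    (hC : ∀ x ∈ Set.Icc (0 : ℝ) 1, |ε x| ≤ C) (j : ℕ → ℕ) {c η : ℝ} (hc : 0 < c) (hη : 0 < η) :
    ∀ᶠ i in atTop, ∀ k ≤ kU i,
      ((j i - max k (kL i) : ℕ) : ℝ) / n i + c / √((n i : ℝ) + l i)
        ≤ (max k (kL i) : ℕ) / l i + scaledDev ε (n i) (l i) k →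
      f (j i - max k (kL i)) (max k (kL i)) (n i) (l i) (scaledDev ε (n i) (l i) k) ≤ η := by
  -- All tolerated rates eventually stay below `m < 1/2`, where the slope of the entropy has a
  -- positive lower bound.
  obtain ⟨m, hm1, hm2⟩ := exists_between H.pU_lt
  have hm0 : 0 < m := H.pL_pos.trans (H.pL_lt.trans hm1)
  have hκ := hSlope_pos hm0 hm2
  have hlim : Tendsto (fun i => (2 : ℝ) ^ (-((n i : ℝ) / √((n i : ℝ) + l i) * (hSlope m * c))))
      atTop (𝓝 0) :=
    (tendsto_rpow_atBot_of_base_gt_one 2 one_lt_two).comp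
      (tendsto_neg_atTop_atBot.comp (H.tendsto_n_div_sqrt.atTop_mul_const (mul_pos hκ hc)))
  have hup := H.tendsto_kU.add (H.tendsto_const_div_sqrt C)
  rw [add_zero] at hup
  filter_upwards [hlim.eventually_lt_const hη, hup.eventually_lt_const hm1,
    H.eventually_abs_scaledDev_le hC, H.eventually_pos, H.eventually_kL_lt_kU]
    with i h1 h2 h3 h4 h5 k hk hcond
  have hl : (0 : ℝ) < l i := by exact_mod_cast h4.2
  have hn : (0 : ℝ) < n i := by exact_mod_cast h4.1
  have hs : 0 < √((n i : ℝ) + l i) := by positivity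
  have hcs : 0 < c / √((n i : ℝ) + l i) := by positivity
  have hle : ((max k (kL i) : ℕ) : ℝ) / l i + scaledDev ε (n i) (l i) k ≤ m := by
    have e1 : ((max k (kL i) : ℕ) : ℝ) / l i ≤ kU i / l i := by
      gcongr
      exact max_le hk h5.le
    linarith [(abs_le.1 (h3 k hk)).2]
  refine (f_le_rpow h4.1 hm0 hm2 (by linarith) hle).trans (le_trans ?_ h1.le)
  refine rpow_le_rpow_of_exponent_le one_le_two (neg_le_neg ?_)
  rw [div_mul_eq_mul_div, mul_div_assoc]
  refine mul_le_mul_of_nonneg_left ?_ hn.le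
  rw [mul_div_assoc]
  refine mul_le_mul_of_nonneg_left ?_ hκ.le
  linarith

/-- If the total error rate is below `pL`, then the error sum vanishes in the limit. -/
theorem eventually_errSum_le_of_lt (H : Regime pL pU r n l kL kU) {ε : ℝ → ℝ} {C : ℝ}
    (hC : ∀ x ∈ Set.Icc (0 : ℝ) 1, |ε x| ≤ C) {j : ℕ → ℕ} {q : ℝ} (hqL : q < pL)
    (hj : ∀ i, j i ≤ n i + l i)
    (hq : Tendsto (fun i => (j i : ℝ) / ((n i : ℝ) + l i)) atTop (𝓝 q)) {η : ℝ} (hη : 0 < η) :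
    ∀ᶠ i in atTop,
      errSum (scaledDev ε (n i) (l i)) (n i) (l i) (kL i) (kU i) (j i) ≤ η := by
  have hkT : Tendsto (fun i => (kL i : ℝ) / ((n i : ℝ) + l i)) atTop (𝓝 (pL * (1 - r))) := by
    refine (H.tendsto_kL.mul H.tendsto_l_ratio).congr' ?_
    filter_upwards [H.eventually_pos] with i hi
    have : (0 : ℝ) < l i := by exact_mod_cast hi.2
    field_simp
  have hlim : Tendsto (fun i => ((j i : ℝ) - kL i) / n i) atTop (𝓝 ((q - pL * (1 - r)) / r)) := by
    refine ((hq.sub hkT).div H.tendsto_ratio H.r_pos.ne').congr' ?_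
    filter_upwards [H.eventually_pos] with i hi
    have : (0 : ℝ) < n i := by exact_mod_cast hi.1
    rw [Pi.div_apply]
    field_simp
  -- If the sample has rate `pL` and the total rate is `q < pL`, the key has rate below `pL`, by a
  -- margin of constant order.
  have hlt : (q - pL * (1 - r)) / r < pL := by
    rw [div_lt_iff₀ H.r_pos]
    linarith
  have hA : Tendsto (fun i => ((j i : ℝ) - kL i) / n i + 1 / √((n i : ℝ) + l i)) atTop
      (𝓝 ((q - pL * (1 - r)) / r)) := by
    simpa using hlim.add (H.tendsto_const_div_sqrt 1)
  have hB : Tendsto (fun i => (kL i : ℝ) / l i - C / √((n i : ℝ) + l i)) atTop (𝓝 pL) := by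
    simpa using H.tendsto_kL.sub (H.tendsto_const_div_sqrt C)
  have hZ : Tendsto (fun i => 1 / √((n i : ℝ) + l i)) atTop (𝓝 0) := H.tendsto_const_div_sqrt 1
  filter_upwards [H.eventually_f_le hC j one_pos hη, hA.eventually_lt hB hlt,
    hZ.eventually_lt hB H.pL_pos, H.eventually_abs_scaledDev_le hC, H.eventually_pos,
    H.eventually_kL_lt_kU] with i h1 h2 h3 h4 h5 h6
  have hl : (0 : ℝ) < l i := by exact_mod_cast h5.2
  have hn : (0 : ℝ) < n i := by exact_mod_cast h5.1
  have := errSum_le_sum_add (δ := scaledDev ε (n i) (l i)) h6.le (hj i) ∅ hη.le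
    (fun k hk _ => h1 k hk ?_)
  · simpa using this
  · have e1 : (kL i : ℝ) / l i ≤ ((max k (kL i) : ℕ) : ℝ) / l i := by
      gcongr
      exact le_max_right _ _
    have e2 := (abs_le.1 (h4 k hk)).1
    have e3 : ((j i - max k (kL i) : ℕ) : ℝ) / n i ≤ ((j i - kL i : ℕ) : ℝ) / n i := by
      gcongr
      exact le_max_right _ _
    rcases le_total (kL i) (j i) with hle | hle
    · rw [Nat.cast_sub hle] at e3
      linarith
    · rw [Nat.sub_eq_zero_of_le hle, Nat.cast_zero, zero_div] at e3
      linarith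

/-- If the total error rate is above `pU`, then the test fails with probability close to one. -/
theorem eventually_errSum_le_of_gt (H : Regime pL pU r n l kL kU) {δ : ℕ → ℕ → ℝ}
    {j : ℕ → ℕ} {q : ℝ} (hqU : pU < q) (hj : ∀ i, j i ≤ n i + l i)
    (hq : Tendsto (fun i => (j i : ℝ) / ((n i : ℝ) + l i)) atTop (𝓝 q)) {η : ℝ} (hη : 0 < η) :
    ∀ᶠ i in atTop, errSum (δ i) (n i) (l i) (kL i) (kU i) (j i) ≤ η := by
  suffices h : ∀ᶠ i in atTop,
      ∑ k ∈ Finset.range (kU i + 1), Phg k (n i) (l i) (j i) ≤ η by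
    filter_upwards [h, H.eventually_kL_lt_kU] with i h1 h2
    rw [errSum_eq_sum_range _ h2.le]
    exact (Finset.sum_le_sum fun k _ => mul_le_of_le_one_right (Phg_nonneg _ _ _ _)
      (f_le_one _ _ _ _ _)).trans h1
  have hq1 : q ≤ 1 := by
    refine le_of_tendsto hq ?_
    filter_upwards [H.tendsto_total.eventually_gt_atTop 0] with i hi
    rw [div_le_one hi]
    exact_mod_cast hj i
  -- At `q = 1` the limiting variance degenerates and Markov's inequality replaces the normal limit.
  rcases hq1.lt_or_eq with hq1 | rfl
  · have hq0 : 0 < q := H.pL_pos.trans (H.pL_lt.trans hqU)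
    have hv0 : 0 < r * (1 - r) * (q * (1 - q)) :=
      mul_pos (mul_pos H.r_pos H.one_sub_r_pos) (mul_pos hq0 (by linarith))
    set σ := √(r * (1 - r) * (q * (1 - q))) with hσ
    have hσ0 : 0 < σ := sqrt_pos.2 hv0
    set v : NNReal := ⟨r * (1 - r) * (q * (1 - q)), hv0.le⟩
    have hvσ : (v : ℝ) = σ ^ 2 := (sq_sqrt hv0.le).symm
    obtain ⟨x, hx⟩ := (tendsto_Phi_atBot.eventually_lt_const hη).exists
    have hmass : 1 - (gaussianReal 0 v).real (Set.Ioi (σ * x)) < η := by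
      rw [← Set.compl_Iic, probReal_compl_eq_one_sub measurableSet_Iic,
        gaussianReal_real_Iic hσ0 hvσ, mul_div_cancel_left₀ _ hσ0.ne']
      linarith
    refine (eventually_sum_Phg_lt H.r_pos H.r_lt hq0 hq1 rfl H.tendsto_n H.tendsto_ratio hq hj
      isOpen_Ioi ?_ hmass).mono fun i hi => hi.le
    -- This is `(kU - mean - σ x √(n + l)) / (n + l)`. Its negative limit puts every `k ≤ kU` below
    -- the quantile `σ x`.
    have hlim : Tendsto (fun i => (kU i : ℝ) / l i * (l i / ((n i : ℝ) + l i))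
        - l i / ((n i : ℝ) + l i) * (j i / ((n i : ℝ) + l i)) - σ * x / √((n i : ℝ) + l i)) atTop
        (𝓝 (pU * (1 - r) - (1 - r) * q - 0)) :=
      ((H.tendsto_kU.mul H.tendsto_l_ratio).sub (H.tendsto_l_ratio.mul hq)).sub
        (H.tendsto_const_div_sqrt _)
    have hneg : pU * (1 - r) - (1 - r) * q - 0 < 0 := by
      nlinarith [mul_pos H.one_sub_r_pos (sub_pos.2 hqU)]
    filter_upwards [hlim.eventually_lt_const hneg, H.eventually_pos] with i h1 h2 k hk
    have hl : (0 : ℝ) < l i := by exact_mod_cast h2.2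
    have hn : (0 : ℝ) < n i := by exact_mod_cast h2.1
    have hT : (0 : ℝ) < (n i : ℝ) + l i := by positivity
    have hs : 0 < √((n i : ℝ) + l i) := by positivity
    rw [Set.mem_Ioi, not_lt, div_le_iff₀ hs]
    have hk' : (k : ℝ) ≤ kU i := by
      exact_mod_cast Nat.lt_succ_iff.1 (Finset.mem_range.1 hk)
    have h3 : ((kU i : ℝ) / l i * (l i / ((n i : ℝ) + l i))
        - l i / ((n i : ℝ) + l i) * (j i / ((n i : ℝ) + l i)) - σ * x / √((n i : ℝ) + l i))
        * ((n i : ℝ) + l i)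
        = kU i - l i * j i / ((n i : ℝ) + l i) - σ * x * √((n i : ℝ) + l i) := by
      have : σ * x / √((n i : ℝ) + l i) * ((n i : ℝ) + l i) = σ * x * √((n i : ℝ) + l i) := by
        rw [div_mul_eq_mul_div, mul_div_assoc, div_sqrt]
      rw [sub_mul, this]
      field_simp
    have h4 := mul_neg_of_neg_of_pos h1 hT
    rw [h3] at h4
    linarith
  · have h1 : pU < 1 := by linarith [H.pU_lt]
    have hlim : Tendsto (fun i => (1 - (j i : ℝ) / ((n i : ℝ) + l i)) / (1 - (kU i : ℝ) / l i))
        atTop (𝓝 0) := by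
      have := (hq.const_sub 1).div (H.tendsto_kU.const_sub 1) (by linarith)
      rwa [sub_self, zero_div] at this
    filter_upwards [hlim.eventually_lt_const hη, H.tendsto_kU.eventually_lt_const h1,
      H.eventually_pos] with i h2 h3 h4
    have hl : (0 : ℝ) < l i := by exact_mod_cast h4.2
    have hkl : (kU i : ℝ) < l i := by rwa [div_lt_one hl] at h3
    have hM := mul_sum_Phg_le (kU := kU i) h4.2 (hj i) (by exact_mod_cast hkl.le)
    refine le_trans ?_ h2.le
    rw [le_div_iff₀ (by linarith)]
    have : (l i : ℝ) * ((∑ k ∈ Finset.range (kU i + 1), Phg k (n i) (l i) (j i))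
        * (1 - kU i / l i)) ≤ l i * (1 - j i / ((n i : ℝ) + l i)) := by
      refine le_trans (le_of_eq ?_) hM
      field_simp
    exact le_of_mul_le_mul_left this hl

end Regime

/-! ### The normal limit for error rates inside `[pL, pU]`. -/

/-- The standardized deviation of `k` from the mean number of errors in the sample. -/
noncomputable def stdDev (n l j k : ℕ) : ℝ :=
  ((k : ℝ) - l * j / ((n : ℝ) + l)) / √((n : ℝ) + l)

/-- The argument of `Phi` in the Gaussian approximation. -/
noncomputable def gaussArg (r : ℝ) (ε : ℝ → ℝ) (p : ℝ) : ℝ :=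
  -(√(r * (1 - r)) / √(p * (1 - p)) * ε p)

/-- Relative to the common mean `j / (n + l)`, a deviation `z` shifts the sample rate by `z √(n + l)
/ l` and the key rate by `-z √(n + l) / n`; moreover `1 / l + 1 / n = (n + l) / (n l)`. -/
theorem rate_gap_eq {n l j k : ℕ} (hn : 0 < n) (hl : 0 < l) (hk : k ≤ j) (e : ℝ) :
    (k : ℝ) / l + e / √((n : ℝ) + l) - ((j - k : ℕ) : ℝ) / n
      = (((n : ℝ) + l) ^ 2 / (n * l) * stdDev n l j k + e) / √((n : ℝ) + l) := by
  have hnR : (0 : ℝ) < n := by exact_mod_cast hn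
  have hlR : (0 : ℝ) < l := by exact_mod_cast hl
  have hss := sq_sqrt (by positivity : (0 : ℝ) ≤ (n : ℝ) + l)
  have hs : 0 < √((n : ℝ) + l) := by positivity
  have h1 : ((n : ℝ) + l) ^ 2 / (n * l) * stdDev n l j k / √((n : ℝ) + l)
      = (k : ℝ) / l - ((j - k : ℕ) : ℝ) / n := by
    rw [stdDev, Nat.cast_sub hk, mul_div_assoc, div_div, ← sq, hss]
    field_simp
    ring
  rw [add_div, h1]
  ring

/-- The right-hand side is the zero of the limiting rescaled gap `z / (r (1 - r)) + ε q`, so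
`gaussArg` is the critical deviation in units of `σ`. -/
theorem gaussArg_eq {r q σ : ℝ} {ε : ℝ → ℝ} (hr : 0 < r * (1 - r)) (hq : 0 < q * (1 - q))
    (hσ : σ = √(r * (1 - r) * (q * (1 - q)))) :
    σ * gaussArg r ε q = -(ε q * (r * (1 - r))) := by
  have h1 : 0 < √(q * (1 - q)) := sqrt_pos.2 hq
  have h2 := mul_self_sqrt hr.le
  rw [hσ, gaussArg, sqrt_mul hr.le]
  calc _ = -(ε q * (√(r * (1 - r)) * √(r * (1 - r)))) := by field_simp
    _ = _ := by rw [h2]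

namespace Regime

variable {pL pU r : ℝ} {n l kL kU : ℕ → ℕ}

/-- On a bounded window of deviations the sample rate is uniformly close to `q`, because `√(n + l) /
l → 0`. This allows `ε (k / l)` to be replaced by `ε q`. -/
theorem eventually_abs_ratio_sub_le (H : Regime pL pU r n l kL kU) {j : ℕ → ℕ} {q : ℝ}
    (hq : Tendsto (fun i => (j i : ℝ) / ((n i : ℝ) + l i)) atTop (𝓝 q)) {B ξ : ℝ}
    (hξ : 0 < ξ) :
    ∀ᶠ i in atTop, ∀ k, |stdDev (n i) (l i) (j i) k| ≤ B → |(k : ℝ) / l i - q| < ξ := by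
  have h1 : Tendsto (fun i => B * (√((n i : ℝ) + l i) / l i)) atTop (𝓝 0) := by
    simpa using H.tendsto_sqrt_div_l.const_mul B
  have h2 : Tendsto (fun i => |(j i : ℝ) / ((n i : ℝ) + l i) - q|) atTop (𝓝 0) := by
    simpa using (hq.sub_const q).abs
  filter_upwards [h1.eventually_lt_const (half_pos hξ), h2.eventually_lt_const (half_pos hξ),
    H.eventually_pos] with i h3 h4 h5 k hk
  have hl : (0 : ℝ) < l i := by exact_mod_cast h5.2
  have hn : (0 : ℝ) < n i := by exact_mod_cast h5.1
  have hs : 0 < √((n i : ℝ) + l i) := by positivity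
  have e1 : (k : ℝ) / l i - q = stdDev (n i) (l i) (j i) k * (√((n i : ℝ) + l i) / l i)
      + ((j i : ℝ) / ((n i : ℝ) + l i) - q) := by
    rw [stdDev]
    field_simp
    ring
  rw [e1]
  refine (abs_add_le _ _).trans_lt ?_
  have e2 : |stdDev (n i) (l i) (j i) k * (√((n i : ℝ) + l i) / l i)|
      ≤ B * (√((n i : ℝ) + l i) / l i) := by
    rw [abs_mul, abs_of_pos (by positivity : 0 < √((n i : ℝ) + l i) / l i)]
    gcongr
  linarith

theorem eventually_abs_dev_sub_le (H : Regime pL pU r n l kL kU) {ε : ℝ → ℝ}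
    (hε : ContinuousOn ε (Set.Icc 0 1)) {j : ℕ → ℕ} {q : ℝ} (hq01 : q ∈ Set.Icc (0 : ℝ) 1)
    (hq : Tendsto (fun i => (j i : ℝ) / ((n i : ℝ) + l i)) atTop (𝓝 q)) {B ξ : ℝ}
    (hξ : 0 < ξ) :
    ∀ᶠ i in atTop, ∀ k ≤ kU i, |stdDev (n i) (l i) (j i) k| ≤ B →
      |ε ((k : ℝ) / l i) - ε q| < ξ := by
  obtain ⟨θ, hθ, hclose⟩ := Metric.continuousWithinAt_iff.1 (hε q hq01) ξ hξ
  filter_upwards [H.eventually_abs_ratio_sub_le hq (B := B) hθ, H.eventually_ratio_mem]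
    with i h1 h2 k hk hB
  exact hclose (h2 k hk) (h1 k hB)

/-- Central limit upper bound for the error sum when the total error rate is in `[pL, pU]`. -/
theorem eventually_errSum_le_of_mem (H : Regime pL pU r n l kL kU) {ε : ℝ → ℝ}
    (hε : ContinuousOn ε (Set.Icc 0 1)) {j : ℕ → ℕ} {q : ℝ} (hqm : q ∈ Set.Icc pL pU)
    (hj : ∀ i, j i ≤ n i + l i)
    (hq : Tendsto (fun i => (j i : ℝ) / ((n i : ℝ) + l i)) atTop (𝓝 q)) {η : ℝ} (hη : 0 < η) :
    ∀ᶠ i in atTop, errSum (scaledDev ε (n i) (l i)) (n i) (l i) (kL i) (kU i) (j i)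
      ≤ Phi (gaussArg r ε q) + η := by
  obtain ⟨C, hC⟩ := isCompact_Icc.exists_bound_of_continuousOn hε
  simp only [norm_eq_abs] at hC
  have hq0 : 0 < q := H.pL_pos.trans_le hqm.1
  have hq1 : q < 1 := by linarith [hqm.2, H.pU_lt]
  have hρ : 0 < r * (1 - r) := mul_pos H.r_pos H.one_sub_r_pos
  have hqq : 0 < q * (1 - q) := mul_pos hq0 (by linarith)
  have hv0 := mul_pos hρ hqq
  set σ := √(r * (1 - r) * (q * (1 - q))) with hσ
  have hσ0 : 0 < σ := sqrt_pos.2 hv0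
  set v : NNReal := ⟨r * (1 - r) * (q * (1 - q)), hv0.le⟩
  have hvσ : (v : ℝ) = σ ^ 2 := (sq_sqrt hv0.le).symm
  -- Moving slightly right of the critical point costs at most `η / 2` in mass and leaves a strictly
  -- positive rescaled gap.
  obtain ⟨x, hx, hxΦ⟩ : ∃ x, gaussArg r ε q < x ∧ Phi x < Phi (gaussArg r ε q) + η / 2 := by
    have h1 : ∀ᶠ x in 𝓝[>] (gaussArg r ε q), Phi x < Phi (gaussArg r ε q) + η / 2 :=
      (continuous_Phi.continuousAt.mono_left nhdsWithin_le_nhds).eventually_lt_const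
        (lt_add_of_pos_right _ (half_pos hη))
    obtain ⟨x, h2, h3⟩ := (h1.and self_mem_nhdsWithin).exists
    exact ⟨x, h3, h2⟩
  have hx' : -(ε q * (r * (1 - r))) < σ * x := by
    rw [← gaussArg_eq hρ hqq hσ]
    exact mul_lt_mul_of_pos_left hx hσ0
  have hgap : 0 < 1 / (r * (1 - r)) * (σ * x) + ε q := by
    have : 1 / (r * (1 - r)) * (σ * x) + ε q = (σ * x + ε q * (r * (1 - r))) / (r * (1 - r)) := by
      rw [add_div, mul_div_cancel_right₀ _ hρ.ne', one_div_mul_eq_div]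
    rw [this]
    exact div_pos (by linarith) hρ
  -- The cap `c < 1` serves large deviations; `ξ` then absorbs the errors in `ε` and in the
  -- coefficient of `z`.
  obtain ⟨c, hc0, hc⟩ := exists_between (lt_min hgap one_pos)
  have hcgap := hc.trans_le (min_le_left _ _)
  have hc1 := hc.trans_le (min_le_right _ _)
  obtain ⟨ξ, hξ0, hξ⟩ := exists_between (sub_pos.2 hcgap)
  have hC0 : 0 ≤ C := (abs_nonneg _).trans (hC q ⟨hq0.le, hq1.le⟩)
  have hf : ∀ᶠ i in atTop, ∀ k ≤ kU i, σ * x < stdDev (n i) (l i) (j i) k →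
      f (j i - max k (kL i)) (max k (kL i)) (n i) (l i) (scaledDev ε (n i) (l i) k) ≤ η / 2 := by
    have hTT := H.tendsto_sq_total_div.mul_const (σ * x)
    have hB : Tendsto (fun i => (kL i : ℝ) / l i - (C + c) / √((n i : ℝ) + l i)) atTop (𝓝 pL) := by
      simpa using H.tendsto_kL.sub (H.tendsto_const_div_sqrt (C + c))
    filter_upwards [H.eventually_f_le hC j hc0 (half_pos hη),
      hTT.eventually_const_lt (show 1 / (r * (1 - r)) * (σ * x) - (1 / (r * (1 - r)) * (σ * x)
        + ε q - c - ξ) < 1 / (r * (1 - r)) * (σ * x) by linarith),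
      hB.eventually_const_lt H.pL_pos, H.eventually_abs_scaledDev_le hC, H.eventually_pos,
      H.eventually_abs_dev_sub_le hε ⟨hq0.le, hq1.le⟩ hq (B := C + 1 + |σ * x|) hξ0,
      H.eventually_ratio_mem] with i h1 h2 h3 h4 h5 h6 h7 k hk hz
    have hl : (0 : ℝ) < l i := by exact_mod_cast h5.2
    have hn : (0 : ℝ) < n i := by exact_mod_cast h5.1
    have hs : 0 < √((n i : ℝ) + l i) := by positivity
    refine h1 k hk ?_
    rcases le_or_gt (max k (kL i)) (j i) with hmj | hmj
    · have hgapk := rate_gap_eq h5.1 h5.2 hmj (ε ((k : ℝ) / l i))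
      have hz' : stdDev (n i) (l i) (j i) k ≤ stdDev (n i) (l i) (j i) (max k (kL i)) := by
        unfold stdDev
        gcongr
        exact le_max_left _ _
      have hkey : c ≤ ((n i : ℝ) + l i) ^ 2 / (n i * l i) * stdDev (n i) (l i) (j i) (max k (kL i))
          + ε ((k : ℝ) / l i) := by
        have hT0 : 0 ≤ ((n i : ℝ) + l i) ^ 2 / (n i * l i) := by positivity
        have hT1 : 1 ≤ ((n i : ℝ) + l i) ^ 2 / (n i * l i) := by
          rw [one_le_div (by positivity)]
          nlinarith
        have hmono := mul_le_mul_of_nonneg_left hz' hT0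
        -- Beyond the window `k / l` need not be near `q`, but the coefficient of `z` is at least
        -- `1` and `ε ≥ -C`, so the gap is at least `1 > c`.
        rcases le_or_gt (stdDev (n i) (l i) (j i) k) (C + 1 + |σ * x|) with hle | hgt
        · have habs : |stdDev (n i) (l i) (j i) k| ≤ C + 1 + |σ * x| :=
            abs_le.2 ⟨by linarith [neg_abs_le (σ * x)], hle⟩
          have h8 := (abs_lt.1 (h6 k hk habs)).1
          have h9 := mul_le_mul_of_nonneg_left hz.le hT0
          linarith
        · have h8 := (abs_le.1 (hC _ (h7 k hk))).1
          have h9 : C + 1 ≤ stdDev (n i) (l i) (j i) k := by linarith [abs_nonneg (σ * x)]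
          have h10 := le_mul_of_one_le_left (by linarith : 0 ≤ stdDev (n i) (l i) (j i) k) hT1
          linarith
      have := div_le_div_of_nonneg_right hkey hs.le
      rw [← hgapk] at this
      unfold scaledDev
      linarith
    · rw [Nat.sub_eq_zero_of_le hmj.le, Nat.cast_zero, zero_div]
      have e1 : (kL i : ℝ) / l i ≤ ((max k (kL i) : ℕ) : ℝ) / l i := by
        gcongr
        exact le_max_right _ _
      have e2 := (abs_le.1 (h4 k hk)).1
      rw [add_div] at h3
      linarith
  have hmass : 1 - (gaussianReal 0 v).real (Set.Ioi (σ * x)) < Phi (gaussArg r ε q) + η / 2 := by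
    rw [← Set.compl_Iic, probReal_compl_eq_one_sub measurableSet_Iic,
      gaussianReal_real_Iic hσ0 hvσ, mul_div_cancel_left₀ _ hσ0.ne']
    linarith
  have hsum := eventually_sum_Phg_lt (J := fun i => (Finset.range (kU i + 1)).filter
      fun k => stdDev (n i) (l i) (j i) k ≤ σ * x) H.r_pos H.r_lt hq0 hq1 (v := v) rfl H.tendsto_n
      H.tendsto_ratio hq hj isOpen_Ioi (Eventually.of_forall fun i k hk =>
        not_lt.2 (Finset.mem_filter.1 hk).2) hmass
  filter_upwards [hf, hsum, H.eventually_kL_lt_kU] with i h1 h2 h3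
  have h4 := errSum_le_sum_add (δ := scaledDev ε (n i) (l i)) h3.le (hj i)
    ((Finset.range (kU i + 1)).filter fun k => stdDev (n i) (l i) (j i) k ≤ σ * x)
    (half_pos hη).le fun k hk hkJ => h1 k hk ?_
  · linarith
  rw [Finset.mem_filter, Finset.mem_range, not_and, not_le] at hkJ
  exact hkJ (by omega)

/-- Central limit lower bound for the error sum when the total error rate is in `(pL, pU)`. -/
theorem eventually_lt_errSum_of_mem (H : Regime pL pU r n l kL kU) {ε : ℝ → ℝ}
    (hε : ContinuousOn ε (Set.Icc 0 1)) {j : ℕ → ℕ} {q : ℝ} (hqm : q ∈ Set.Ioo pL pU)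
    (hq : Tendsto (fun i => (j i : ℝ) / ((n i : ℝ) + l i)) atTop (𝓝 q)) {η : ℝ} (hη : 0 < η) :
    ∀ᶠ i in atTop, Phi (gaussArg r ε q) - η
      < errSum (scaledDev ε (n i) (l i)) (n i) (l i) (kL i) (kU i) (j i) := by
  obtain ⟨C, hC⟩ := isCompact_Icc.exists_bound_of_continuousOn hε
  simp only [norm_eq_abs] at hC
  have hq0 : 0 < q := H.pL_pos.trans hqm.1
  have hq1 : q < 1 := by linarith [hqm.2, H.pU_lt]
  have hρ : 0 < r * (1 - r) := mul_pos H.r_pos H.one_sub_r_pos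
  have hqq : 0 < q * (1 - q) := mul_pos hq0 (by linarith)
  have hv0 := mul_pos hρ hqq
  set σ := √(r * (1 - r) * (q * (1 - q))) with hσ
  have hσ0 : 0 < σ := sqrt_pos.2 hv0
  set v : NNReal := ⟨r * (1 - r) * (q * (1 - q)), hv0.le⟩
  have hvσ : (v : ℝ) = σ ^ 2 := (sq_sqrt hv0.le).symm
  obtain ⟨x, hx, hxΦ⟩ : ∃ x, x < gaussArg r ε q ∧ Phi (gaussArg r ε q) - η / 2 < Phi x := by
    have h1 : ∀ᶠ x in 𝓝[<] (gaussArg r ε q), Phi (gaussArg r ε q) - η / 2 < Phi x :=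
      (continuous_Phi.continuousAt.mono_left nhdsWithin_le_nhds).eventually_const_lt
        (sub_lt_self _ (half_pos hη))
    obtain ⟨x, h2, h3⟩ := (h1.and self_mem_nhdsWithin).exists
    exact ⟨x, h3, h2⟩
  obtain ⟨x', hxx', hx'⟩ := exists_between hx
  -- Cutting off the left tail below `σ b` makes the window bounded, as needed to control `ε (k /
  -- l)`.
  obtain ⟨b, hb⟩ := (tendsto_Phi_atBot.eventually_lt_const (half_pos hη)).exists
  have hx'ε : σ * x' < -(ε q * (r * (1 - r))) := by
    rw [← gaussArg_eq hρ hqq hσ]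
    exact mul_lt_mul_of_pos_left hx' hσ0
  have hgap : 1 / (r * (1 - r)) * (σ * x') + ε q < 0 := by
    have : 1 / (r * (1 - r)) * (σ * x') + ε q = (σ * x' + ε q * (r * (1 - r))) / (r * (1 - r)) := by
      rw [add_div, mul_div_cancel_right₀ _ hρ.ne', one_div_mul_eq_div]
    rw [this]
    exact div_neg_of_neg_of_pos (by linarith) hρ
  obtain ⟨ξ, hξ0, hξ⟩ := exists_between (neg_pos.2 hgap)
  have hmass : Phi (gaussArg r ε q) - η
      < (gaussianReal 0 v).real (Set.Ioo (σ * b) (σ * x')) := by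
    have hsub : Set.Iic (σ * x) ⊆ Set.Iic (σ * b) ∪ Set.Ioo (σ * b) (σ * x') := fun y hy => by
      rcases le_or_gt y (σ * b) with h | h
      · exact Or.inl h
      · exact Or.inr ⟨h, lt_of_le_of_lt hy (mul_lt_mul_of_pos_left hxx' hσ0)⟩
    have h1 := (measureReal_mono (μ := gaussianReal 0 v) hsub).trans (measureReal_union_le _ _)
    rw [gaussianReal_real_Iic hσ0 hvσ, gaussianReal_real_Iic hσ0 hvσ,
      mul_div_cancel_left₀ _ hσ0.ne', mul_div_cancel_left₀ _ hσ0.ne'] at h1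
    linarith
  set B := |σ * b| + |σ * x'|
  have hBz : ∀ z, σ * b < z → z < σ * x' → |z| ≤ B := fun z h1 h2 =>
    abs_le.2 ⟨by linarith [neg_abs_le (σ * b), abs_nonneg (σ * x')],
      by linarith [le_abs_self (σ * x'), abs_nonneg (σ * b)]⟩
  obtain ⟨a₁, ha₁, ha₁q⟩ := exists_between hqm.1
  obtain ⟨a₂, hqa₂, ha₂⟩ := exists_between hqm.2
  -- Here `q` must be interior: the whole window then avoids both thresholds, and `max k kL = k`.
  have hbound : ∀ᶠ i in atTop, ∀ k, |stdDev (n i) (l i) (j i) k| ≤ B → kL i < k ∧ k < kU i := by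
    filter_upwards [H.eventually_abs_ratio_sub_le hq (B := B)
      (lt_min (sub_pos.2 ha₁q) (sub_pos.2 hqa₂)), H.tendsto_kL.eventually_lt_const ha₁,
      H.tendsto_kU.eventually_const_lt ha₂, H.eventually_pos] with i h1 h2 h3 h4 k hk
    have hl : (0 : ℝ) < l i := by exact_mod_cast h4.2
    have h5 := abs_lt.1 ((h1 k hk).trans_le (min_le_left _ _))
    have h6 := abs_lt.1 ((h1 k hk).trans_le (min_le_right _ _))
    constructor
    · have : (kL i : ℝ) / l i < k / l i := by linarith
      rw [div_lt_div_iff_of_pos_right hl] at this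
      exact_mod_cast this
    · have : (k : ℝ) / l i < kU i / l i := by linarith
      rw [div_lt_div_iff_of_pos_right hl] at this
      exact_mod_cast this
  have hsum := eventually_lt_sum_Phg (J := fun i => (Finset.range (kU i + 1)).filter
      fun k => stdDev (n i) (l i) (j i) k ∈ Set.Ioo (σ * b) (σ * x')) H.r_pos H.r_lt hq0 hq1
      (v := v) rfl H.tendsto_n H.tendsto_ratio hq isOpen_Ioo (by
        filter_upwards [hbound] with i hi k hk _
        have hk' : stdDev (n i) (l i) (j i) k ∈ Set.Ioo (σ * b) (σ * x') := hk
        refine Finset.mem_filter.2 ⟨Finset.mem_range.2 ?_, hk'⟩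
        have := (hi k (hBz _ hk'.1 hk'.2)).2
        omega) hmass
  have hTT := H.tendsto_sq_total_div.mul_const (σ * x')
  have hlow : Tendsto (fun i => (kL i : ℝ) / l i - C / √((n i : ℝ) + l i)) atTop (𝓝 pL) := by
    simpa using H.tendsto_kL.sub (H.tendsto_const_div_sqrt C)
  filter_upwards [hsum, hbound, H.eventually_kL_lt_kU, H.eventually_pos,
    H.eventually_abs_dev_sub_le hε ⟨hq0.le, hq1.le⟩ hq (B := B) hξ0,
    hTT.eventually_lt_const (show 1 / (r * (1 - r)) * (σ * x') < -ε q - ξ by linarith),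
    hlow.eventually_const_lt H.pL_pos, H.eventually_abs_scaledDev_le hC]
    with i h1 h2 h3 h4 h5 h6 h7 h8
  refine h1.trans_le (sum_Phg_le_errSum h3.le _ (Finset.filter_subset _ _) fun k hk hkj => ?_)
  obtain ⟨hkr, hkz⟩ := Finset.mem_filter.1 hk
  have hB' := hBz _ hkz.1 hkz.2
  obtain ⟨hk1, hk2⟩ := h2 k hB'
  have hl : (0 : ℝ) < l i := by exact_mod_cast h4.2
  have hn : (0 : ℝ) < n i := by exact_mod_cast h4.1
  have hs : 0 < √((n i : ℝ) + l i) := by positivity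
  rw [max_eq_left hk1.le]
  refine f_eq_one ?_ ?_
  · have e1 : (kL i : ℝ) / l i ≤ (k : ℝ) / l i := by gcongr
    have e2 := (abs_le.1 (h8 k hk2.le)).1
    linarith
  · have hgapk := rate_gap_eq h4.1 h4.2 hkj (ε ((k : ℝ) / l i))
    have hT0 : 0 ≤ ((n i : ℝ) + l i) ^ 2 / (n i * l i) := by positivity
    have e1 := mul_le_mul_of_nonneg_left hkz.2.le hT0
    have e2 := (abs_lt.1 (h5 k hk2.le hB')).2
    have e3 : (((n i : ℝ) + l i) ^ 2 / (n i * l i) * stdDev (n i) (l i) (j i) k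
        + ε ((k : ℝ) / l i)) / √((n i : ℝ) + l i) ≤ 0 :=
      div_nonpos_of_nonpos_of_nonneg (by linarith) hs.le
    rw [← hgapk] at e3
    unfold scaledDev
    linarith

end Regime

/-! ### Uniformity in `j` and the limit of the bound. -/

theorem continuousOn_Phi_gaussArg {pL pU r : ℝ} (hpL : 0 < pL) (hpU : pU < 1) {ε : ℝ → ℝ}
    (hε : ContinuousOn ε (Set.Icc 0 1)) :
    ContinuousOn (fun p => Phi (gaussArg r ε p)) (Set.Icc pL pU) := by
  have hsub : Set.Icc pL pU ⊆ Set.Icc 0 1 := Set.Icc_subset_Icc hpL.le hpU.le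
  refine continuous_Phi.comp_continuousOn ?_
  unfold gaussArg
  refine ((continuousOn_const.div ?_ fun p hp => ?_).mul (hε.mono hsub)).neg
  · fun_prop
  · have : 0 < p * (1 - p) := mul_pos (hpL.trans_le hp.1) (by linarith [hp.2])
    exact (sqrt_pos.2 this).ne'

namespace Regime

variable {pL pU r : ℝ} {n l kL kU : ℕ → ℕ}

/-- The upper bound on the error sum holds uniformly in the number of errors. -/
theorem eventually_forall_errSum_le (H : Regime pL pU r n l kL kU) {ε : ℝ → ℝ}
    (hε : ContinuousOn ε (Set.Icc 0 1)) {M : ℝ} (hM0 : 0 ≤ M)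
    (hM : ∀ p ∈ Set.Icc pL pU, Phi (gaussArg r ε p) ≤ M) {η : ℝ} (hη : 0 < η) :
    ∀ᶠ i in atTop, ∀ j ≤ n i + l i,
      errSum (scaledDev ε (n i) (l i)) (n i) (l i) (kL i) (kU i) j ≤ M + η := by
  -- Violating values of `j` along a subsequence would have error rates accumulating at some `q`;
  -- each of the three positions of `q` contradicts a pointwise bound.
  by_contra hcon
  obtain ⟨φ, hφ, hφP⟩ := extraction_of_frequently_atTop (not_eventually.1 hcon)
  push Not at hφP
  choose j hj hbig using hφP
  obtain ⟨q, -, ψ, hψ, hq⟩ := (isCompact_Icc (a := (0 : ℝ)) (b := 1)).tendsto_subseq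
    (x := fun i => (j i : ℝ) / ((n (φ i) : ℝ) + l (φ i))) fun i => by
      have h1 : (j i : ℝ) ≤ (n (φ i) : ℝ) + l (φ i) := by exact_mod_cast hj i
      exact ⟨by positivity, div_le_one_of_le₀ h1 (by positivity)⟩
  obtain ⟨C, hC⟩ := isCompact_Icc.exists_bound_of_continuousOn hε
  simp only [norm_eq_abs] at hC
  have H' := (H.comp hφ).comp hψ
  have hj' : ∀ i, (j ∘ ψ) i ≤ (n ∘ φ ∘ ψ) i + (l ∘ φ ∘ ψ) i := fun i => hj (ψ i)
  have key : ∀ᶠ i in atTop, errSum (scaledDev ε (n (φ (ψ i))) (l (φ (ψ i)))) (n (φ (ψ i)))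
      (l (φ (ψ i))) (kL (φ (ψ i))) (kU (φ (ψ i))) (j (ψ i)) ≤ M + η := by
    rcases lt_or_ge q pL with h1 | h1
    · refine (H'.eventually_errSum_le_of_lt hC h1 hj' hq hη).mono fun i hi => ?_
      exact hi.trans (by linarith)
    · rcases lt_or_ge pU q with h2 | h2
      · refine (H'.eventually_errSum_le_of_gt (δ := fun i => scaledDev ε (n (φ (ψ i)))
          (l (φ (ψ i)))) h2 hj' hq hη).mono fun i hi => ?_
        exact hi.trans (by linarith)
      · refine (H'.eventually_errSum_le_of_mem hε ⟨h1, h2⟩ hj' hq hη).mono fun i hi => ?_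
        exact hi.trans (by linarith [hM q ⟨h1, h2⟩])
  obtain ⟨i, hi⟩ := key.exists
  exact absurd hi (not_le.2 (hbig (ψ i)))

/-- The maximal error sum is asymptotically at least the value of the Gaussian approximation at
every interior point. -/
theorem eventually_exists_lt_errSum (H : Regime pL pU r n l kL kU) {ε : ℝ → ℝ}
    (hε : ContinuousOn ε (Set.Icc 0 1)) {p : ℝ} (hp : p ∈ Set.Ioo pL pU) {η : ℝ} (hη : 0 < η) :
    ∀ᶠ i in atTop, ∃ j ≤ n i + l i, Phi (gaussArg r ε p) - η
      < errSum (scaledDev ε (n i) (l i)) (n i) (l i) (kL i) (kU i) j := by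
  have hp0 : 0 < p := H.pL_pos.trans hp.1
  have hp1 : p < 1 := by linarith [hp.2, H.pU_lt]
  have hq : Tendsto (fun i => ((⌊p * ((n i : ℝ) + l i)⌋₊ : ℕ) : ℝ) / ((n i : ℝ) + l i)) atTop
      (𝓝 p) := (tendsto_nat_floor_mul_div_atTop hp0.le).comp H.tendsto_total
  filter_upwards [H.eventually_lt_errSum_of_mem hε hp hq hη] with i hi
  refine ⟨_, Nat.floor_le_of_le ?_, hi⟩
  push_cast
  exact mul_le_of_le_one_left (by positivity) hp1.le

/-- The entropy term of the bound vanishes in the limit. -/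
theorem tendsto_entropy_term (H : Regime pL pU r n l kL kU) {ε : ℝ → ℝ}
    (hε : ContinuousOn ε (Set.Icc 0 1)) {R : ℕ → ℝ}
    (hR : ∃ R₀ : ℝ, h pU < R₀ ∧ ∀ᶠ i in atTop, R₀ ≤ R i) :
    Tendsto (fun i => (Finset.range (n i + l i + 1)).sup' Finset.nonempty_range_add_one
      (fun j => 1 / ((n i : ℝ) * (R i - h ((kU i : ℝ) / l i + scaledDev ε (n i) (l i) (kU i))))
        * hBar (errSum (scaledDev ε (n i) (l i)) (n i) (l i) (kL i) (kU i) j))) atTop (𝓝 0) := by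
  obtain ⟨R₀, hR₀, hRle⟩ := hR
  obtain ⟨C, hC⟩ := isCompact_Icc.exists_bound_of_continuousOn hε
  simp only [norm_eq_abs] at hC
  -- Eventually the entropy at `kU` is below `R₁`, so the denominator is at least `n (R₀ - R₁)`.
  obtain ⟨R₁, hR₁, hR₁₀⟩ := exists_between hR₀
  have hδ : Tendsto (fun i => scaledDev ε (n i) (l i) (kU i)) atTop (𝓝 0) :=
    squeeze_zero_norm' ((H.eventually_abs_scaledDev_le hC).mono fun i hi => hi _ le_rfl)
      (H.tendsto_const_div_sqrt C)
  have hh : Tendsto (fun i => h ((kU i : ℝ) / l i + scaledDev ε (n i) (l i) (kU i))) atTop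
      (𝓝 (h pU)) := by
    have := H.tendsto_kU.add hδ
    rw [add_zero] at this
    exact (continuous_h.tendsto _).comp this
  have hd : 0 < R₀ - R₁ := sub_pos.2 hR₁₀
  have hup : Tendsto (fun i => 1 / ((n i : ℝ) * (R₀ - R₁))) atTop (𝓝 0) :=
    tendsto_const_nhds.div_atTop (H.tendsto_nR.atTop_mul_const hd)
  have hpos : ∀ᶠ i in atTop, 0 < n i ∧
      R₀ - R₁ ≤ R i - h ((kU i : ℝ) / l i + scaledDev ε (n i) (l i) (kU i)) := by
    filter_upwards [hRle, hh.eventually_lt_const hR₁, H.eventually_pos] with i h1 h2 h3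
    exact ⟨h3.1, by linarith⟩
  refine tendsto_of_tendsto_of_tendsto_of_le_of_le' tendsto_const_nhds hup ?_ ?_
  · filter_upwards [hpos] with i hi
    have h0 : 0 < R i - h ((kU i : ℝ) / l i + scaledDev ε (n i) (l i) (kU i)) := hd.trans_le hi.2
    refine Finset.le_sup'_of_le _ (Finset.mem_range.2 (Nat.succ_pos _)) ?_
    exact mul_nonneg (by positivity) (hBar_nonneg (errSum_nonneg _ _ _ _ _ _))
  · filter_upwards [hpos] with i hi
    have h0 : 0 < R i - h ((kU i : ℝ) / l i + scaledDev ε (n i) (l i) (kU i)) := hd.trans_le hi.2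
    have hn : (0 : ℝ) < n i := by exact_mod_cast hi.1
    refine Finset.sup'_le _ _ fun j _ => ?_
    refine (mul_le_of_le_one_right (by positivity) (hBar_le_one _)).trans ?_
    exact one_div_le_one_div_of_le (mul_pos hn hd) (mul_le_mul_of_nonneg_left hi.2 hn.le)

/-- The Gaussian approximation of the bound. -/
theorem tendsto_PTilde (H : Regime pL pU r n l kL kU) {ε : ℝ → ℝ}
    (hε : ContinuousOn ε (Set.Icc 0 1)) {R : ℕ → ℝ}
    (hR : ∃ R₀ : ℝ, h pU < R₀ ∧ ∀ᶠ i in atTop, R₀ ≤ R i) {M : ℝ}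
    (hM : IsGreatest ((fun p => Phi (gaussArg r ε p)) '' Set.Icc pL pU) M) :
    Tendsto (fun i => PTilde (R i) (scaledDev ε (n i) (l i)) (n i) (l i) (kL i) (kU i)) atTop
      (𝓝 M) := by
  have hcont := continuousOn_Phi_gaussArg (r := r) H.pL_pos (by linarith [H.pU_lt] : pU < 1) hε
  obtain ⟨⟨p₀, hp₀, hp₀M⟩, hMub⟩ := hM
  have hle : ∀ p ∈ Set.Icc pL pU, Phi (gaussArg r ε p) ≤ M := fun p hp => hMub ⟨p, hp, rfl⟩
  have hM0 : 0 ≤ M := hp₀M ▸ Phi_nonneg _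
  have hsup : Tendsto (fun i => (Finset.range (n i + l i + 1)).sup' Finset.nonempty_range_add_one
      (fun j => errSum (scaledDev ε (n i) (l i)) (n i) (l i) (kL i) (kU i) j)) atTop (𝓝 M) := by
    refine tendsto_order.2 ⟨fun a ha => ?_, fun a ha => ?_⟩
    -- The maximiser may be an endpoint, where no lower bound is available; continuity moves it into
    -- the interior.
    · obtain ⟨p, hp, hpa⟩ : ∃ p ∈ Set.Ioo pL pU, a < Phi (gaussArg r ε p) := by
        have hclos : p₀ ∈ closure (Set.Ioo pL pU) := by rwa [closure_Ioo H.pL_lt.ne]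
        have := mem_closure_iff_nhdsWithin_neBot.1 hclos
        have h1 : Tendsto (fun p => Phi (gaussArg r ε p)) (𝓝[Set.Ioo pL pU] p₀) (𝓝 M) :=
          hp₀M ▸ (hcont p₀ hp₀).mono_left (nhdsWithin_mono _ Set.Ioo_subset_Icc_self)
        obtain ⟨p, h2, h3⟩ := ((h1.eventually_const_lt ha).and self_mem_nhdsWithin).exists
        exact ⟨p, h3, h2⟩
      filter_upwards [H.eventually_exists_lt_errSum hε hp (sub_pos.2 hpa)] with i ⟨j, hj, hlt⟩
      rw [sub_sub_cancel] at hlt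
      exact hlt.trans_le (Finset.le_sup' (fun j => errSum (scaledDev ε (n i) (l i)) (n i) (l i)
        (kL i) (kU i) j) (Finset.mem_range.2 (Nat.lt_succ_of_le hj)))
    · filter_upwards [H.eventually_forall_errSum_le hε hM0 hle (half_pos (sub_pos.2 ha))] with i hi
      refine (Finset.sup'_le _ _ fun j hj => hi j (Nat.lt_succ_iff.1 (Finset.mem_range.1 hj))).trans_lt
        (by linarith)
  have := (H.tendsto_entropy_term (kL := kL) hε hR).add hsup
  rw [zero_add] at this
  exact this

end Regime

end QKD

theorem mainTheorem7
    (pL pU r : ℝ) (hpL : 0 < pL) (hpLU : pL < pU) (hpU : pU < 1 / 2)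
    (hr0 : 0 < r) (hr1 : r < 1)
    (ε : ℝ → ℝ) (hε : ContinuousOn ε (Set.Icc 0 1))
    (n l kL kU : ℕ → ℕ)
    (hn : Filter.Tendsto n Filter.atTop Filter.atTop)
    (hr : Filter.Tendsto (fun i => (n i : ℝ) / ((n i : ℝ) + (l i : ℝ))) Filter.atTop (nhds r))
    (hkL : Filter.Tendsto (fun i => (kL i : ℝ) / (l i : ℝ)) Filter.atTop (nhds pL))
    (hkU : Filter.Tendsto (fun i => (kU i : ℝ) / (l i : ℝ)) Filter.atTop (nhds pU))
    (R : ℕ → ℝ) (hR : ∃ R₀ : ℝ, QKD.h pU < R₀ ∧ ∀ᶠ i in Filter.atTop, R₀ ≤ R i) :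
    ∃ M : ℝ,
      IsGreatest
        ((fun p : ℝ => QKD.Phi (-(√(r * (1 - r)) / √(p * (1 - p)) * ε p))) '' Set.Icc pL pU) M ∧
      Filter.Tendsto
        (fun i => QKD.PTilde (R i)
          (fun k => ε ((k : ℝ) / (l i : ℝ)) / √((n i : ℝ) + (l i : ℝ)))
          (n i) (l i) (kL i) (kU i))
        Filter.atTop (nhds M) := by
  have H : QKD.Regime pL pU r n l kL kU := ⟨hpL, hpLU, hpU, hr0, hr1, hn, hr, hkL, hkU⟩
  obtain ⟨M, hM⟩ := (isCompact_Icc.image_of_continuousOn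
    (QKD.continuousOn_Phi_gaussArg (r := r) hpL (by linarith : pU < 1) hε)).exists_isGreatest
    ((Set.nonempty_Icc.2 hpLU.le).image _)
  exact ⟨M, hM, H.tendsto_PTilde hε hR hM⟩
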